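/- Let $d\ge 0$ and let $\pi=(\pi^{ij})$ be a smooth Poisson structure on $\mathbb{R}^d$. Let $T^*\mathbb{R}^d$ have coordinates $(x^i,p_i)$ and canonical symplectic form $\omega_0=\sum_i dp_i\wedge dx^i$, and let $\{f,g\}_{\Omega}=\sum_{a,b}\Omega^{ab}\,\partial_af\,\partial_bg$ be the Poisson bracket of a (formal) symplectic form $\Omega$, where $(\Omega^{ab})$ is the inverse of the matrix of components $\Omega_{ab}=\Omega(\partial_a,\partial_b)$; thus $\{x^i,p_j\}_{\omega_0}=\delta^i_j$. Put $\overline V=-\sum_{i,j}\pi^{ij}(x)p_i\,\partial_{x^j}$, with formal flow $\varphi_s(x,p)=(\bar x_s,p)$, $\bar x_s^i=\sum_{n\ge0}\frac{s^n}{n!}L_{\overline V}^n(x^i)$, and define formal power series in $\epsilon$ $$\phi^i_\epsilon=\frac1\epsilon\int_0^\epsilon \bar x^i_s\,ds=\sum_{n\ge 0}\frac{\epsilon^n}{(n+1)!}L_{\overline V}^n(x^i),\qquad \omega_{\overline V,\epsilon}=\frac1\epsilon\int_0^\epsilon\varphi_s^*\omega_0\,ds .$$ For $w_\epsilon=w_0+\epsilon\tilde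 w_\epsilon$ with $w_\epsilon^i\in C^\infty(T^*\mathbb{R}^d)[[\epsilon]]$, and for $f\in C^\infty(T^*\mathbb R^d)$, formal composition means the Taylor expansion $$f(w_\epsilon(x,p),p)=\sum_{n\ge0}\frac{\epsilon^n}{n!}\sum_{i_1,\dots,i_n}\tilde w_\epsilon^{i_1}\cdots\tilde w_\epsilon^{i_n}\,\frac{\partial^nf}{\partial x^{i_1}\cdots\partial x^{i_n}}(w_0(x,p),p),$$ extended to $f\in C^\infty(T^*\mathbb{R}^d)[[\epsilon]]$ coefficientwise. A formal symplectic realization $(T^*\mathbb{R}^d,\Omega_\epsilon)\to(\mathbb{R}^d,\epsilon\pi)$ is a family $s^i_\epsilon=x^i+O(\epsilon)$ in $C^\infty(T^*\mathbb{R}^d)[[\epsilon]]$ such that $\Omega_\epsilon$ is a formal symplectic form (antisymmetric, closed, non-degenerate) and $\{s_\epsilon^i,s_\epsilon^j\}_{\Omega_\epsilon}=\epsilon\,\pi^{ij}(s_\epsilon)$ at all orders in $\epsilon$. **Theorem.** There is a unique family $\alpha_\epsilon=(\alpha_\epsilon^i)$ in $C^\infty(T^*\mathbb{R}^d)[[\epsilon]]$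 with $\phi_\epsilon(\alpha_\epsilon(x,p),p)=x$. It is a formal symplectic realization $(T^*\mathbb{R}^d,\omega_0)\to(\mathbb{R}^d,\epsilon\pi)$, i.e. $\{\alpha_\epsilon^i,\alpha_\epsilon^j\}_{\omega_0}=\epsilon\,\pi^{ij}(\alpha_\epsilon)$ at all orders in $\epsilon$. Moreover, the bundle projection $q(x,p)=x$ is a formal symplectic realization $(T^*\mathbb{R}^d,\omega_{\overline V,\epsilon})\to(\mathbb{R}^d,\epsilon\pi)$ (the formal Weinstein realization), and the formal map $\psi_\epsilon^{-1}(x,p)=(\alpha_\epsilon(x,p),p)$ is a formal Darboux frame that takes it to $\alpha_\epsilon$: it is the two-sided formal inverse of $\psi_\epsilon(x,p)=(\phi_\epsilon(x,p),p)$, it satisfies $(\psi_\epsilon^{-1})^*\omega_{\overline V,\epsilon}=\omega_0$, and $q\circ\psi_\epsilon^{-1}=\alpha_\epsilon$. -/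

import Mathlib

open scoped ContDiff

noncomputable section

namespace FormalRealization

/-- The partial derivative `∂f/∂z^a` of a function on `ℝ^ι`. -/
def pderiv {ι : Type} [Fintype ι] [DecidableEq ι] (a : ι) (f : (ι → ℝ) → ℝ) : (ι → ℝ) → ℝ :=
  fun z => fderiv ℝ f z (Pi.single a 1)

/-- A (smooth) Poisson structure on `ℝ^d`, given by the components `π^{ij} = {x^i, x^j}` of its
bivector field: smooth, antisymmetric, and satisfying the Jacobi identity. -/
structure PoissonStructure (d : ℕ) where
  /-- the component functions `π^{ij}` -/
  comp : Fin d → Fin d → (Fin d → ℝ) → ℝ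
  smooth : ∀ i j, ContDiff ℝ ∞ (comp i j)
  antisymm : ∀ i j x, comp i j x = -comp j i x
  jacobi : ∀ i j k x,
    ∑ l, (comp i l x * pderiv l (comp j k) x + comp j l x * pderiv l (comp k i) x
      + comp k l x * pderiv l (comp i j) x) = 0

/-- `T^*ℝ^d`, with coordinates `x^i` (index `Sum.inl i`) and `p_i` (index `Sum.inr i`). -/
abbrev Phase (d : ℕ) : Type := Fin d ⊕ Fin d → ℝ

/-- The algebra `C^∞(T^*ℝ^d)`. -/
def Smooth (d : ℕ) : Subalgebra ℝ (Phase d → ℝ) where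
  carrier := {f | ContDiff ℝ ∞ f}
  mul_mem' {f g} hf hg := by
    have hf' : ContDiff ℝ ∞ f := hf
    have hg' : ContDiff ℝ ∞ g := hg
    exact hf'.mul hg'
  add_mem' {f g} hf hg := by
    have hf' : ContDiff ℝ ∞ f := hf
    have hg' : ContDiff ℝ ∞ g := hg
    exact hf'.add hg'
  algebraMap_mem' r := by
    have h : ContDiff ℝ ∞ (fun _ : Phase d => r) := contDiff_const
    exact h

theorem Smooth.contDiff {d : ℕ} (f : Smooth d) : ContDiff ℝ ∞ f.1 := f.2

/-- A smooth function on `T^*ℝ^d`, as an element of `C^∞(T^*ℝ^d)`. -/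
def Smooth.mk {d : ℕ} (f : Phase d → ℝ) (hf : ContDiff ℝ ∞ f) : Smooth d := ⟨f, hf⟩

/-- The algebra `C^∞(T^*ℝ^d)[[ε]]`. -/
abbrev Formal (d : ℕ) : Type := PowerSeries (Smooth d)

variable {d : ℕ}

/-- The coordinate function `z^a` on `T^*ℝ^d`. -/
def coord (a : Fin d ⊕ Fin d) : Smooth d :=
  Smooth.mk (fun z => z a) (contDiff_apply ℝ ℝ a)

/-- The partial derivative `∂/∂z^a` on `C^∞(T^*ℝ^d)`. -/
def partialD (a : Fin d ⊕ Fin d) (f : Smooth d) : Smooth d :=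
  Smooth.mk (pderiv a f.1)
    (((Smooth.contDiff f).fderiv_right (m := ∞) (by simp)).clm_apply contDiff_const)

/-- The partial derivative `∂/∂z^a` on `C^∞(T^*ℝ^d)[[ε]]`, coefficient by coefficient. -/
def partialF (a : Fin d ⊕ Fin d) (f : Formal d) : Formal d :=
  PowerSeries.mk fun n => partialD a (PowerSeries.coeff n f)

/-! ### Formal maps and formal composition

A formal map `(x, p) ↦ (w_ε(x, p), p)` of `T^*ℝ^d` that fixes the momenta is given by the family
`w^i_ε ∈ C^∞(T^*ℝ^d)[[ε]]`. -/

/-- The iterated partial derivative `∂^n f / ∂x^{i_1} ⋯ ∂x^{i_n}`. -/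
def partialX {n : ℕ} (i : Fin n → Fin d) (f : Smooth d) : Smooth d :=
  (List.ofFn i).foldr (fun k g => partialD (Sum.inl k) g) f

/-- The function `(x, p) ↦ g(w_0(x, p), p)`. -/
def compLeading (g : Smooth d) (w₀ : Fin d → Smooth d) : Smooth d :=
  Smooth.mk (fun z => g.1 (Sum.elim (fun i => (w₀ i).1 z) (fun j => z (Sum.inr j)))) (by
    refine ContDiff.comp (Smooth.contDiff g) (contDiff_pi.2 ?_)
    rintro (i | j)
    · exact Smooth.contDiff (w₀ i)
    · exact contDiff_apply ℝ ℝ (Sum.inr j))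

/-- For `w = w_0 + ε w̃`, the series `w̃`. -/
def tail (w : Formal d) : Formal d :=
  PowerSeries.mk fun n => PowerSeries.coeff (n + 1) w

/-- The formal composition `f(w_ε(x, p), p)` of a smooth function `f` with a formal map
`w_ε = w_0 + ε w̃_ε`, i.e. its Taylor expansion
`∑_n ε^n / n! ∑_{i_1, …, i_n} w̃^{i_1} ⋯ w̃^{i_n} (∂^n f / ∂x^{i_1} ⋯ ∂x^{i_n})(w_0(x, p), p)`. -/
def compSmooth (f : Smooth d) (w : Fin d → Formal d) : Formal d :=
  PowerSeries.mk fun N => ∑ nm ∈ Finset.HasAntidiagonal.antidiagonal N,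
    ((nm.1.factorial : ℝ)⁻¹) • ∑ i : Fin nm.1 → Fin d,
      PowerSeries.coeff nm.2 (∏ k, tail (w (i k))) *
        compLeading (partialX i f) (fun j => PowerSeries.coeff 0 (w j))

/-- The formal composition `f_ε(w_ε(x, p), p) = ∑_k ε^k f_k(w_ε(x, p), p)` of a formal series
`f_ε = ∑_k ε^k f_k` with a formal map. -/
def compFormal (f : Formal d) (w : Fin d → Formal d) : Formal d :=
  PowerSeries.mk fun N => ∑ km ∈ Finset.HasAntidiagonal.antidiagonal N,
    PowerSeries.coeff km.2 (compSmooth (PowerSeries.coeff km.1 f) w)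

/-- The composition `v ∘ w` of formal maps `(x, p) ↦ (v(x, p), p)` and `(x, p) ↦ (w(x, p), p)`. -/
def compMap (v w : Fin d → Formal d) : Fin d → Formal d :=
  fun i => compFormal (v i) w

/-- The coordinates `x^i`, as constant formal series: the components of the bundle projection
`q : T^*ℝ^d → ℝ^d`, and equally the identity formal map `(x, p) ↦ (x, p)`. -/
def proj (d : ℕ) : Fin d → Formal d :=
  fun i => PowerSeries.C (coord (Sum.inl i))

/-! ### Formal two-forms

A formal two-form `Ω` on `T^*ℝ^d` is given by the matrix of its components
`Ω_{ab} = Ω(∂_a, ∂_b) ∈ C^∞(T^*ℝ^d)[[ε]]`. -/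

/-- Matrices with entries in `C^∞(T^*ℝ^d)[[ε]]`, indexed by the coordinates of `T^*ℝ^d`. -/
abbrev FMatrix (d : ℕ) : Type := Matrix (Fin d ⊕ Fin d) (Fin d ⊕ Fin d) (Formal d)

/-- The canonical form `ω₀ = ∑_i dp_i ∧ dx^i`: `ω₀(∂_{p_i}, ∂_{x^i}) = 1`. -/
def omega0 (d : ℕ) : FMatrix d := Matrix.fromBlocks 0 (-1) 1 0

/-- Formal symplectic forms: antisymmetric, closed, and non-degenerate. -/
structure IsFormalSymplectic (Ω : FMatrix d) : Prop where
  antisymm : Ω.transpose = -Ω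
  closed : ∀ a b c, partialF a (Ω b c) + partialF b (Ω c a) + partialF c (Ω a b) = 0
  nondegenerate : IsUnit Ω.det

/-- The Poisson bracket of a formal symplectic form, `{f, g}_Ω = ∑ Ω^{ab} ∂_a f ∂_b g` with
`(Ω^{ab})` the inverse of the matrix `(Ω_{ab})`; that is, `{f, g} = X_f g` where `i_{X_f} Ω = df`.
For `ω₀` it is `{f, g} = ∑_i (∂f/∂x^i ∂g/∂p_i - ∂f/∂p_i ∂g/∂x^i)`. -/
def bracket (Ω : FMatrix d) (f g : Formal d) : Formal d :=
  ∑ a, ∑ b, Ω⁻¹ a b * partialF a f * partialF b g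

/-- The Jacobian matrix of the formal map `(x, p) ↦ (w(x, p), p)`. -/
def jacobian (w : Fin d → Formal d) : FMatrix d :=
  Matrix.of fun a b =>
    partialF b (Sum.elim w (fun j => PowerSeries.C (coord (Sum.inr j))) a)

/-- The pullback of a formal two-form under the formal map `(x, p) ↦ (w(x, p), p)`. -/
def pullback (w : Fin d → Formal d) (Ω : FMatrix d) : FMatrix d :=
  (jacobian w).transpose * Ω.map (fun f => compFormal f w) * jacobian w

/-! ### The formal realizations -/

namespace PoissonStructure

/-- `π^{ij}`, as a function on `T^*ℝ^d` that does not depend on the momenta. -/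
def lift (P : PoissonStructure d) (i j : Fin d) : Smooth d :=
  Smooth.mk (fun z => P.comp i j (fun k => z (Sum.inl k)))
    ((P.smooth i j).comp (contDiff_pi.2 fun k => contDiff_apply ℝ ℝ (Sum.inl k)))

/-- The Lie derivative of functions along the opposite flat Poisson spray
`V̄ = -∑_{i, j} π^{ij}(x) p_i ∂/∂x^j`. -/
def lieV (P : PoissonStructure d) (f : Smooth d) : Smooth d :=
  -∑ i, ∑ j, P.lift i j * coord (Sum.inr i) * partialD (Sum.inl j) f

/-- The formal flow `(x, p) ↦ (exp(s V̄)(x), p)` of `V̄`, with components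
`∑_n s^n / n! L_{V̄}^n (x^i)`; the formal variable of the series stands for `s`. -/
def flow (P : PoissonStructure d) : Fin d → Formal d :=
  fun i => PowerSeries.mk fun n => ((n.factorial : ℝ)⁻¹) • (P.lieV)^[n] (coord (Sum.inl i))

/-- The formal map `φ_ε`, with components `∑_n ε^n / (n+1)! L_{V̄}^n (x^i)`. -/
def phi (P : PoissonStructure d) : Fin d → Formal d :=
  fun i => PowerSeries.mk fun n =>
    (((n + 1).factorial : ℝ)⁻¹) • (P.lieV)^[n] (coord (Sum.inl i))

end PoissonStructure

/-- The formal average `(1/ε) ∫_0^ε f_s ds`, i.e. `∑_n s^n f_n ↦ ∑_n ε^n f_n / (n+1)`. -/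
def average (f : Formal d) : Formal d :=
  PowerSeries.mk fun n => ((n + 1 : ℝ)⁻¹) • PowerSeries.coeff n f

/-- The formal Weinstein form `ω_{V̄,ε} = (1/ε) ∫_0^ε (φ_s^{V̄})^* ω₀ ds`. -/
def PoissonStructure.omegaV (P : PoissonStructure d) : FMatrix d :=
  (pullback P.flow (omega0 d)).map average

/-- `s_ε` is a formal symplectic realization `(T^*ℝ^d, Ω_ε) → (ℝ^d, επ)`: the formal two-form
`Ω_ε` is symplectic, `s_ε = x + O(ε)`, and `{s^i, s^j}_Ω = ε π^{ij}(s)` to all orders in `ε`. -/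
structure IsFormalRealization (P : PoissonStructure d) (Ω : FMatrix d) (s : Fin d → Formal d) :
    Prop where
  symplectic : IsFormalSymplectic Ω
  leading : ∀ i, PowerSeries.coeff 0 (s i) = coord (Sum.inl i)
  bracket_eq : ∀ i j, bracket Ω (s i) (s j) = PowerSeries.X * compSmooth (P.lift i j) s

/-- The formal map `Ψ : (x, p) ↦ (w(x, p), p)` is a formal (global) Darboux frame for `Ω`, with
formal inverse `Ψ' : (x, p) ↦ (v(x, p), p)`: the two maps are inverse to each other, and
`Ψ^* Ω = ω₀`. -/
structure IsFormalDarbouxFrame (Ω : FMatrix d) (w v : Fin d → Formal d) : Prop where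
  inv_comp : compMap v w = proj d
  comp_inv : compMap w v = proj d
  pullback_eq : pullback w Ω = omega0 d

end FormalRealization

end

noncomputable section

namespace FormalRealization

variable {d : ℕ}

/-! ### Partial derivatives of smooth functions -/

/-! A formal map that fixes the momenta pulls `ω₀` back to `∑ dp_i ∧ dw^i`, which is linear in `w`.
Averaging the pullbacks along the flow of `V̄` is therefore the same as pulling back along the
averaged flow: `omegaV` is `ψ^* ω₀` with `ψ = (φ, p)` (`PoissonStructure.omegaV_eq`). Hence `ψ⁻¹` is
a Darboux frame, and what remains is the bracket of the positions.

Write `A = ∂φ/∂x` and `B = ∂φ/∂p`. The position block of the inverse of `ψ^* ω₀` is `A⁻¹ (B - Bᵀ)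
A⁻ᵀ`, so the projection is a realization as soon as `∂φ^i/∂p_j - ∂φ^j/∂p_i = ε {φ^i, φ^j}_π`, where
`{,}_π` differentiates in `x` only (`partialF_inr_phi_sub`). The Jacobi identity makes `L_V̄` a
derivation of `{,}_π`, and `[∂/∂p_j, V̄] = -{x^j, ·}_π`. Comparing formal differential equations in
`ε` then gives `∂x̄^i/∂p_j = {x̄^i, ∫ x̄^j}_π`, and one more integration gives the identity for `φ`.
Composing with `α = φ⁻¹`, which is a ring homomorphism obeying the chain rule, carries the bracket
relation to `ω₀`.

The formal calculus rests on one device, `eq_of_dEps_congr`: an identity is differentiated in `ε`,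
its derivative involves only instances of the same identity, and induction modulo powers of `ε`
concludes. The inverse of `φ = x + O(ε)` is the fixed point of an `ε`-adic contraction. -/

theorem Smooth.ext {f g : Smooth d} (h : ∀ z, f.1 z = g.1 z) : f = g :=
  Subtype.ext (funext h)

theorem Smooth.neg_mul (f g : Smooth d) : -f * g = -(f * g) := _root_.neg_mul f g

theorem Smooth.mul_neg (f g : Smooth d) : f * -g = -(f * g) := _root_.mul_neg f g

theorem Formal.neg_mul (f g : Formal d) : -f * g = -(f * g) := _root_.neg_mul f g

theorem Smooth.differentiableAt (f : Smooth d) (z : Phase d) : DifferentiableAt ℝ f.1 z :=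
  (Smooth.contDiff f).differentiable (by simp) z

theorem partialD_apply (a : Fin d ⊕ Fin d) (f : Smooth d) (z : Phase d) :
    (partialD a f).1 z = fderiv ℝ f.1 z (Pi.single a 1) := rfl

theorem partialD_add (a : Fin d ⊕ Fin d) (f g : Smooth d) :
    partialD a (f + g) = partialD a f + partialD a g := by
  refine Smooth.ext fun z => ?_
  have h : fderiv ℝ (f + g).1 z = fderiv ℝ f.1 z + fderiv ℝ g.1 z :=
    fderiv_add (Smooth.differentiableAt f z) (Smooth.differentiableAt g z)
  rw [partialD_apply, h]
  rfl

theorem partialD_mul (a : Fin d ⊕ Fin d) (f g : Smooth d) :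
    partialD a (f * g) = partialD a f * g + f * partialD a g := by
  refine Smooth.ext fun z => ?_
  have h : fderiv ℝ (f * g).1 z = f.1 z • fderiv ℝ g.1 z + g.1 z • fderiv ℝ f.1 z :=
    fderiv_mul (Smooth.differentiableAt f z) (Smooth.differentiableAt g z)
  rw [partialD_apply, h]
  change f.1 z * (partialD a g).1 z + g.1 z * (partialD a f).1 z
    = (partialD a f).1 z * g.1 z + f.1 z * (partialD a g).1 z
  ring

theorem partialD_algebraMap (a : Fin d ⊕ Fin d) (r : ℝ) :
    partialD a (algebraMap ℝ (Smooth d) r) = 0 := by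
  refine Smooth.ext fun z => ?_
  have h : fderiv ℝ (algebraMap ℝ (Smooth d) r).1 z = 0 :=
    fderiv_const_apply (𝕜 := ℝ) (E := Phase d) r
  rw [partialD_apply, h]
  rfl

theorem partialD_smul (a : Fin d ⊕ Fin d) (r : ℝ) (f : Smooth d) :
    partialD a (r • f) = r • partialD a f := by
  rw [Algebra.smul_def, Algebra.smul_def, partialD_mul, partialD_algebraMap, zero_mul, zero_add]

/-- The partial derivative as a derivation of `C^∞(T^*ℝ^d)`. -/
def partialDDerivation (a : Fin d ⊕ Fin d) : Derivation ℝ (Smooth d) (Smooth d) :=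
  Derivation.mk'
    { toFun := partialD a
      map_add' := partialD_add a
      map_smul' := partialD_smul a }
    fun f g => by
      change partialD a (f * g) = f * partialD a g + g * partialD a f
      rw [partialD_mul]; ring

theorem partialD_zero (a : Fin d ⊕ Fin d) : partialD a (0 : Smooth d) = 0 :=
  map_zero (partialDDerivation a)

theorem partialD_one (a : Fin d ⊕ Fin d) : partialD a (1 : Smooth d) = 0 :=
  (partialDDerivation a).map_one_eq_zero

theorem partialD_neg (a : Fin d ⊕ Fin d) (f : Smooth d) : partialD a (-f) = -partialD a f :=
  map_neg (partialDDerivation a) f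

theorem partialD_sum {ι : Type*} (s : Finset ι) (a : Fin d ⊕ Fin d) (f : ι → Smooth d) :
    partialD a (∑ i ∈ s, f i) = ∑ i ∈ s, partialD a (f i) :=
  map_sum (partialDDerivation a) f s

theorem partialD_coord (a b : Fin d ⊕ Fin d) :
    partialD a (coord b) = if a = b then 1 else 0 := by
  refine Smooth.ext fun z => ?_
  have h : fderiv ℝ (coord b).1 z = ContinuousLinearMap.proj (R := ℝ) (φ := fun _ => ℝ) b :=
    (ContinuousLinearMap.proj (R := ℝ) (φ := fun _ : Fin d ⊕ Fin d => ℝ) b).fderiv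
  rw [partialD_apply, h]
  by_cases hab : a = b
  · subst hab
    rw [if_pos rfl]
    simp
  · rw [if_neg hab]
    simp [Ne.symm hab]

theorem partialD_comm (a b : Fin d ⊕ Fin d) (f : Smooth d) :
    partialD a (partialD b f) = partialD b (partialD a f) := by
  refine Smooth.ext fun z => ?_
  have hd : DifferentiableAt ℝ (fderiv ℝ f.1) z :=
    ((Smooth.contDiff f).fderiv_right (m := ∞) (by simp)).differentiable (by simp) z
  have key (u v : Phase d) :
      fderiv ℝ (fun y => fderiv ℝ f.1 y u) z v = fderiv ℝ (fderiv ℝ f.1) z v u := by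
    rw [fderiv_clm_apply hd (differentiableAt_const u)]
    simp
  have hs : IsSymmSndFDerivAt ℝ f.1 z :=
    (Smooth.contDiff f).contDiffAt.isSymmSndFDerivAt (by
      rw [minSmoothness_of_isRCLikeNormedField]; exact WithTop.coe_le_coe.2 le_top)
  change fderiv ℝ (fun y => fderiv ℝ f.1 y (Pi.single b 1)) z (Pi.single a 1)
    = fderiv ℝ (fun y => fderiv ℝ f.1 y (Pi.single a 1)) z (Pi.single b 1)
  rw [key, key]
  exact hs.eq _ _

/-! ### Partial derivatives and the derivative in `ε` of formal series -/

theorem coeff_partialF (a : Fin d ⊕ Fin d) (f : Formal d) (n : ℕ) :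
    PowerSeries.coeff n (partialF a f) = partialD a (PowerSeries.coeff n f) :=
  PowerSeries.coeff_mk _ _

/-- The partial derivative as a derivation of `C^∞(T^*ℝ^d)[[ε]]`. -/
def partialFDerivation (a : Fin d ⊕ Fin d) : Derivation ℝ (Formal d) (Formal d) :=
  Derivation.mk'
    { toFun := partialF a
      map_add' := fun f g => by
        ext1 n
        simp only [coeff_partialF, map_add, partialD_add]
      map_smul' := fun r f => by
        ext1 n
        simp only [coeff_partialF, RingHom.id_apply, PowerSeries.coeff_smul, partialD_smul] }
    fun f g => by
      change partialF a (f * g) = f * partialF a g + g * partialF a f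
      ext1 n
      rw [mul_comm g]
      simp only [coeff_partialF, map_add, PowerSeries.coeff_mul, partialD_sum, partialD_mul,
        Finset.sum_add_distrib]
      ring

theorem partialF_add (a : Fin d ⊕ Fin d) (f g : Formal d) :
    partialF a (f + g) = partialF a f + partialF a g :=
  map_add (partialFDerivation a) f g

theorem partialF_sub (a : Fin d ⊕ Fin d) (f g : Formal d) :
    partialF a (f - g) = partialF a f - partialF a g :=
  map_sub (partialFDerivation a) f g

theorem partialF_neg (a : Fin d ⊕ Fin d) (f : Formal d) : partialF a (-f) = -partialF a f :=
  map_neg (partialFDerivation a) f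

theorem partialF_zero (a : Fin d ⊕ Fin d) : partialF a (0 : Formal d) = 0 :=
  map_zero (partialFDerivation a)

theorem partialF_one (a : Fin d ⊕ Fin d) : partialF a (1 : Formal d) = 0 :=
  (partialFDerivation a).map_one_eq_zero

theorem partialF_sum {ι : Type*} (s : Finset ι) (a : Fin d ⊕ Fin d) (f : ι → Formal d) :
    partialF a (∑ i ∈ s, f i) = ∑ i ∈ s, partialF a (f i) :=
  map_sum (partialFDerivation a) f s

theorem partialF_mul (a : Fin d ⊕ Fin d) (f g : Formal d) :
    partialF a (f * g) = partialF a f * g + f * partialF a g := by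
  have h := (partialFDerivation a).leibniz f g
  change partialF a (f * g) = f * partialF a g + g * partialF a f at h
  rw [h]; ring

theorem partialF_C (a : Fin d ⊕ Fin d) (f : Smooth d) :
    partialF a (PowerSeries.C f) = PowerSeries.C (partialD a f) := by
  ext1 n
  rw [coeff_partialF, PowerSeries.coeff_C, PowerSeries.coeff_C]
  split_ifs
  · rfl
  · exact partialD_zero a

theorem partialF_X (a : Fin d ⊕ Fin d) : partialF a (PowerSeries.X : Formal d) = 0 := by
  ext1 n
  rw [coeff_partialF, PowerSeries.coeff_X]
  split_ifs
  · exact partialD_one a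
  · exact partialD_zero a

theorem partialF_comm (a b : Fin d ⊕ Fin d) (f : Formal d) :
    partialF a (partialF b f) = partialF b (partialF a f) := by
  ext1 n
  simp only [coeff_partialF, partialD_comm a b]

/-- The derivative with respect to the formal variable. -/
def dEps (f : Formal d) : Formal d := PowerSeries.derivative (Smooth d) f

theorem coeff_dEps (f : Formal d) (n : ℕ) :
    PowerSeries.coeff n (dEps f) = ((n + 1 : ℕ) : ℝ) • PowerSeries.coeff (n + 1) f := by
  rw [dEps, PowerSeries.coeff_derivative, Algebra.smul_def, mul_comm]
  simp

/-- Characteristic zero enters here: `n + 1` can be divided out, so identities can be integrated in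
`ε`. -/
theorem coeff_succ_eq_of_dEps {f g : Formal d} {n : ℕ}
    (h : PowerSeries.coeff n (dEps f) = PowerSeries.coeff n (dEps g)) :
    PowerSeries.coeff (n + 1) f = PowerSeries.coeff (n + 1) g := by
  rw [coeff_dEps, coeff_dEps] at h
  have hn : ((n + 1 : ℕ) : ℝ) ≠ 0 := Nat.cast_ne_zero.2 n.succ_ne_zero
  exact smul_right_injective (Smooth d) hn h

theorem eq_of_dEps_eq {f g : Formal d} (h0 : PowerSeries.coeff 0 f = PowerSeries.coeff 0 g)
    (h : dEps f = dEps g) : f = g := by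
  ext1 n
  cases n with
  | zero => exact h0
  | succ n => exact coeff_succ_eq_of_dEps (by rw [h])

theorem dEps_mul (f g : Formal d) : dEps (f * g) = dEps f * g + f * dEps g := by
  have h := (PowerSeries.derivative (Smooth d)).leibniz f g
  rw [smul_eq_mul, smul_eq_mul] at h
  change dEps (f * g) = f * dEps g + g * dEps f at h
  rw [h]; ring

theorem dEps_zero : dEps (0 : Formal d) = 0 :=
  map_zero (PowerSeries.derivative (Smooth d))

theorem dEps_add (f g : Formal d) : dEps (f + g) = dEps f + dEps g :=
  map_add (PowerSeries.derivative (Smooth d)) f g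

theorem dEps_sub (f g : Formal d) : dEps (f - g) = dEps f - dEps g :=
  map_sub (PowerSeries.derivative (Smooth d)) f g

theorem dEps_sum {ι : Type*} (s : Finset ι) (f : ι → Formal d) :
    dEps (∑ i ∈ s, f i) = ∑ i ∈ s, dEps (f i) :=
  map_sum (PowerSeries.derivative (Smooth d)) f s

theorem dEps_X : dEps (PowerSeries.X : Formal d) = 1 :=
  PowerSeries.derivative_X

theorem dEps_C (f : Smooth d) : dEps (PowerSeries.C f) = 0 :=
  PowerSeries.derivative_C

theorem dEps_smul (r : ℝ) (f : Formal d) : dEps (r • f) = r • dEps f := by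
  ext1 n
  simp only [coeff_dEps, PowerSeries.coeff_smul, smul_comm r]

theorem dEps_partialF (a : Fin d ⊕ Fin d) (f : Formal d) :
    dEps (partialF a f) = partialF a (dEps f) := by
  ext1 n
  rw [coeff_dEps, coeff_partialF, coeff_partialF, coeff_dEps, partialD_smul]

/-- Two families of formal series are equal if their leading coefficients agree and if their
derivatives in `ε` agree modulo every ideal modulo which the families agree. -/
theorem eq_of_dEps_congr {ι : Type*} {E F : ι → Formal d}
    (h0 : ∀ i, PowerSeries.coeff 0 (E i) = PowerSeries.coeff 0 (F i))
    (h : ∀ {Q : Type} [CommRing Q] (q : Formal d →+* Q), (∀ i, q (E i) = q (F i)) →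
      ∀ i, q (dEps (E i)) = q (dEps (F i))) (i : ι) : E i = F i := by
  have key : ∀ n i, ∀ m < n + 1, PowerSeries.coeff m (E i) = PowerSeries.coeff m (F i) := by
    intro n
    induction n with
    | zero =>
      intro i m hm
      obtain rfl : m = 0 := by omega
      exact h0 i
    | succ n ih =>
      -- Agreement of the coefficients below `n + 1` is equality in the quotient by `X ^ (n + 1)`,
      -- where ring identities may be used freely. Since `dEps` lowers degrees by one, each round
      -- gains one coefficient.
      have hq : ∀ f g : Formal d,
          Ideal.Quotient.mk (Ideal.span {(PowerSeries.X : Formal d) ^ (n + 1)}) f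
            = Ideal.Quotient.mk (Ideal.span {(PowerSeries.X : Formal d) ^ (n + 1)}) g ↔
          ∀ m < n + 1, PowerSeries.coeff m f = PowerSeries.coeff m g := fun f g => by
        rw [Ideal.Quotient.mk_eq_mk_iff_sub_mem, Ideal.mem_span_singleton,
          PowerSeries.X_pow_dvd_iff]
        simp only [map_sub, sub_eq_zero]
      have h' := h (Q := Formal d ⧸ Ideal.span {(PowerSeries.X : Formal d) ^ (n + 1)})
        (Ideal.Quotient.mk _) (fun i => (hq _ _).2 (ih i))
      intro i m hm
      cases m with
      | zero => exact h0 i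
      | succ m => exact coeff_succ_eq_of_dEps ((hq _ _).1 (h' i) m (by omega))
  ext1 n
  exact key n i n n.lt_succ_self

theorem coeff_zero_mul (f g : Formal d) :
    PowerSeries.coeff 0 (f * g) = PowerSeries.coeff 0 f * PowerSeries.coeff 0 g := by
  simp only [PowerSeries.coeff_zero_eq_constantCoeff, map_mul]

/-! ### The Taylor expansion -/

theorem coeff_tail (w : Formal d) (n : ℕ) :
    PowerSeries.coeff n (tail w) = PowerSeries.coeff (n + 1) w :=
  PowerSeries.coeff_mk _ _

theorem eq_C_add_X_mul_tail (w : Formal d) :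
    w = PowerSeries.C (PowerSeries.coeff 0 w) + PowerSeries.X * tail w := by
  ext1 n
  cases n with
  | zero => simp
  | succ n => simp [PowerSeries.coeff_succ_X_mul, coeff_tail]

theorem dEps_X_mul_tail (w : Formal d) : dEps (PowerSeries.X * tail w) = dEps w := by
  conv_rhs => rw [eq_C_add_X_mul_tail w]
  rw [dEps_add, dEps_C, zero_add]

/-- The leading coefficients of a family of formal series. -/
def leadingCoeffs (w : Fin d → Formal d) : Fin d → Smooth d :=
  fun j => PowerSeries.coeff 0 (w j)

/-- The homogeneous part
`∑_{i_1, …, i_n} (w - w_0)^{i_1} ⋯ (w - w_0)^{i_n} (∂^n f / ∂x^{i_1} ⋯ ∂x^{i_n})(w_0(x, p), p)`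
of the Taylor expansion. -/
def taylorPart (w : Fin d → Formal d) : ℕ → Smooth d → Formal d
  | 0, f => PowerSeries.C (compLeading f (leadingCoeffs w))
  | n + 1, f => ∑ j, (PowerSeries.X * tail (w j)) * taylorPart w n (partialD (Sum.inl j) f)

/-- `partialX` folds from the right, so the last index is differentiated first; the recursion of
`taylorPart` therefore peels off the last index. -/
theorem partialX_snoc {n : ℕ} (i : Fin n → Fin d) (j : Fin d) (f : Smooth d) :
    partialX (Fin.snoc i j : Fin (n + 1) → Fin d) f = partialX i (partialD (Sum.inl j) f) := by
  unfold partialX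
  rw [List.ofFn_succ']
  simp [List.concat_eq_append]

theorem taylorPart_eq (w : Fin d → Formal d) (n : ℕ) (f : Smooth d) :
    taylorPart w n f = PowerSeries.X ^ n * ∑ i : Fin n → Fin d, (∏ k, tail (w (i k))) *
      PowerSeries.C (compLeading (partialX i f) (leadingCoeffs w)) := by
  induction n generalizing f with
  | zero =>
    simp [taylorPart, partialX]
  | succ n ih =>
    rw [← (Fin.snocEquiv fun _ : Fin (n + 1) => Fin d).sum_comp, Fintype.sum_prod_type, taylorPart,
      Finset.mul_sum]
    refine Finset.sum_congr rfl fun j _ => ?_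
    rw [ih, Finset.mul_sum, Finset.mul_sum, Finset.mul_sum]
    refine Finset.sum_congr rfl fun i _ => ?_
    change _ = _ * ((∏ k, tail (w ((Fin.snoc i j : Fin (n + 1) → Fin d) k))) *
      PowerSeries.C (compLeading (partialX (Fin.snoc i j : Fin (n + 1) → Fin d) f)
        (leadingCoeffs w)))
    rw [partialX_snoc, Fin.prod_univ_castSucc]
    simp only [Fin.snoc_castSucc, Fin.snoc_last]
    ring

/-- The product rule hits each of the `n + 1` factors `X * tail (w j)`, and these contributions
coincide because partial derivatives commute. -/
theorem dEps_taylorPart (w : Fin d → Formal d) (n : ℕ) (f : Smooth d) :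
    dEps (taylorPart w (n + 1) f)
      = ((n + 1 : ℕ) : ℝ) • ∑ j, dEps (w j) * taylorPart w n (partialD (Sum.inl j) f) := by
  have hd : ∀ j g, dEps (PowerSeries.X * tail (w j) * g)
      = dEps (w j) * g + PowerSeries.X * tail (w j) * dEps g := fun j g => by
    rw [dEps_mul, dEps_X_mul_tail]
  induction n generalizing f with
  | zero =>
    simp only [taylorPart, dEps_sum, hd, dEps_C]
    simp
  | succ n ih =>
    rw [taylorPart, dEps_sum]
    simp only [hd, ih, Finset.sum_add_distrib]
    have h : ∀ j, taylorPart w (n + 1) (partialD (Sum.inl j) f)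
        = ∑ k, (PowerSeries.X * tail (w k)) *
          taylorPart w n (partialD (Sum.inl j) (partialD (Sum.inl k) f)) := fun j => by
      rw [taylorPart]
      simp only [partialD_comm (Sum.inl j)]
    simp only [h, mul_smul_comm, ← Finset.smul_sum, Finset.mul_sum]
    rw [Finset.sum_comm (f := fun i j => PowerSeries.X * tail (w i) * _)]
    rw [Nat.cast_succ (n + 1), add_smul, one_smul, add_comm]
    congr 2
    refine Finset.sum_congr rfl fun j _ => Finset.sum_congr rfl fun k _ => ?_
    ring

theorem coeff_taylorPart (w : Fin d → Formal d) (f : Smooth d) {n N : ℕ} (h : n ≤ N) :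
    PowerSeries.coeff N (taylorPart w n f) = ∑ i : Fin n → Fin d,
      PowerSeries.coeff (N - n) (∏ k, tail (w (i k))) *
        compLeading (partialX i f) (leadingCoeffs w) := by
  rw [taylorPart_eq, PowerSeries.coeff_X_pow_mul', if_pos h, map_sum]
  simp only [PowerSeries.coeff_mul_C]

theorem coeff_taylorPart_of_lt (w : Fin d → Formal d) (f : Smooth d) {n N : ℕ} (h : N < n) :
    PowerSeries.coeff N (taylorPart w n f) = 0 := by
  rw [taylorPart_eq, PowerSeries.coeff_X_pow_mul', if_neg (by omega)]

/-- The part of degree `n` is divisible by `X ^ n`, so any truncation beyond `N` computes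
coefficient `N`. The free bound `M` lets different truncations be compared. -/
theorem coeff_compSmooth (f : Smooth d) (w : Fin d → Formal d) {N M : ℕ} (h : N < M) :
    PowerSeries.coeff N (compSmooth f w)
      = PowerSeries.coeff N (∑ n ∈ Finset.range M, ((n.factorial : ℝ)⁻¹) • taylorPart w n f) := by
  rw [compSmooth, PowerSeries.coeff_mk, map_sum]
  rw [Finset.Nat.sum_antidiagonal_eq_sum_range_succ_mk]
  rw [← Finset.sum_subset (Finset.range_mono (Nat.succ_le_of_lt h)) (fun n _ hn => by
    rw [PowerSeries.coeff_smul, coeff_taylorPart_of_lt w f (by simpa using hn), smul_zero])]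
  refine Finset.sum_congr rfl fun n hn => ?_
  rw [PowerSeries.coeff_smul, coeff_taylorPart w f (Nat.lt_succ_iff.1 (Finset.mem_range.1 hn))]
  rfl

theorem coeff_zero_compSmooth (f : Smooth d) (w : Fin d → Formal d) :
    PowerSeries.coeff 0 (compSmooth f w) = compLeading f (leadingCoeffs w) := by
  rw [coeff_compSmooth f w zero_lt_one]
  simp [taylorPart]

theorem coeff_mul_congr_right {f g h : Formal d} {N : ℕ}
    (hgh : ∀ m ≤ N, PowerSeries.coeff m g = PowerSeries.coeff m h) :
    PowerSeries.coeff N (f * g) = PowerSeries.coeff N (f * h) := by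
  rw [PowerSeries.coeff_mul, PowerSeries.coeff_mul]
  refine Finset.sum_congr rfl fun x hx => ?_
  rw [hgh _ (by have := Finset.HasAntidiagonal.mem_antidiagonal.1 hx; omega)]

theorem coeff_mul_congr_left {f g h : Formal d} {N : ℕ}
    (hgh : ∀ m ≤ N, PowerSeries.coeff m g = PowerSeries.coeff m h) :
    PowerSeries.coeff N (g * f) = PowerSeries.coeff N (h * f) := by
  rw [mul_comm g, mul_comm h, coeff_mul_congr_right hgh]

theorem dEps_compSmooth (f : Smooth d) (w : Fin d → Formal d) :
    dEps (compSmooth f w) = ∑ j, dEps (w j) * compSmooth (partialD (Sum.inl j) f) w := by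
  ext1 N
  -- Coefficient `N` of the derivative reads coefficient `N + 1`, whence the bound `N + 2`. The term
  -- `n = 0` is constant in `ε`, and the other `N + 1` terms match the right side.
  have h1 : PowerSeries.coeff N (dEps (compSmooth f w)) = PowerSeries.coeff N
      (dEps (∑ n ∈ Finset.range (N + 2), ((n.factorial : ℝ)⁻¹) • taylorPart w n f)) := by
    rw [coeff_dEps, coeff_dEps, coeff_compSmooth f w (Nat.lt_succ_self _)]
  have h2 : ∀ j, PowerSeries.coeff N (dEps (w j) * compSmooth (partialD (Sum.inl j) f) w)
      = PowerSeries.coeff N (dEps (w j) * ∑ n ∈ Finset.range (N + 1),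
        ((n.factorial : ℝ)⁻¹) • taylorPart w n (partialD (Sum.inl j) f)) := fun j =>
    coeff_mul_congr_right fun m hm => coeff_compSmooth _ w (Nat.lt_succ_of_le hm)
  rw [h1, map_sum (PowerSeries.coeff N)]
  simp only [h2]
  rw [← map_sum]
  congr 1
  rw [Finset.sum_range_succ', dEps_add, dEps_sum]
  simp only [dEps_smul, dEps_taylorPart, Finset.mul_sum]
  rw [Finset.sum_comm]
  have h3 : dEps (taylorPart w 0 f) = 0 := dEps_C _
  rw [h3, smul_zero, add_zero]
  refine Finset.sum_congr rfl fun n _ => ?_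
  rw [smul_smul]
  have h4 : (((n + 1).factorial : ℝ)⁻¹) * ((n + 1 : ℕ) : ℝ) = (n.factorial : ℝ)⁻¹ := by
    rw [Nat.factorial_succ]
    push_cast
    field_simp
  rw [h4, Finset.smul_sum]
  simp only [mul_smul_comm]

/-! ### Formal composition -/

theorem coeff_compFormal (f : Formal d) (w : Fin d → Formal d) (N : ℕ) :
    PowerSeries.coeff N (compFormal f w) = ∑ km ∈ Finset.HasAntidiagonal.antidiagonal N,
      PowerSeries.coeff km.2 (compSmooth (PowerSeries.coeff km.1 f) w) :=
  PowerSeries.coeff_mk _ _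

theorem coeff_zero_compFormal (f : Formal d) (w : Fin d → Formal d) :
    PowerSeries.coeff 0 (compFormal f w)
      = compLeading (PowerSeries.coeff 0 f) (leadingCoeffs w) := by
  rw [coeff_compFormal, Finset.Nat.antidiagonal_zero, Finset.sum_singleton]
  exact coeff_zero_compSmooth _ w

theorem compLeading_add (f g : Smooth d) (w₀ : Fin d → Smooth d) :
    compLeading (f + g) w₀ = compLeading f w₀ + compLeading g w₀ := rfl

theorem compLeading_mul (f g : Smooth d) (w₀ : Fin d → Smooth d) :
    compLeading (f * g) w₀ = compLeading f w₀ * compLeading g w₀ := rfl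

theorem compLeading_smul (r : ℝ) (f : Smooth d) (w₀ : Fin d → Smooth d) :
    compLeading (r • f) w₀ = r • compLeading f w₀ := rfl

theorem compSmooth_add (f g : Smooth d) (w : Fin d → Formal d) :
    compSmooth (f + g) w = compSmooth f w + compSmooth g w := by
  -- The family ranges over all pairs, because differentiating the claim for `(f, g)` yields the
  -- claim for their partial derivatives.
  refine eq_of_dEps_congr (ι := Smooth d × Smooth d)
    (E := fun x => compSmooth (x.1 + x.2) w)
    (F := fun x => compSmooth x.1 w + compSmooth x.2 w) (fun x => ?_) (fun q hq x => ?_) (f, g)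
  · simp only [coeff_zero_compSmooth, map_add, compLeading_add]
  · have h : ∀ a b, q (compSmooth (a + b) w) = q (compSmooth a w + compSmooth b w) :=
      fun a b => hq (a, b)
    simp only [dEps_add, dEps_compSmooth, partialD_add, map_add, map_sum, map_mul, h, mul_add,
      Finset.sum_add_distrib]

theorem compSmooth_zero (w : Fin d → Formal d) : compSmooth 0 w = 0 := by
  have h := compSmooth_add 0 0 w
  rwa [add_zero, left_eq_add] at h

theorem compSmooth_smul (r : ℝ) (f : Smooth d) (w : Fin d → Formal d) :
    compSmooth (r • f) w = r • compSmooth f w := by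
  refine eq_of_dEps_congr (E := fun f => compSmooth (r • f) w)
    (F := fun f => r • compSmooth f w) (fun f => ?_) (fun q hq f => ?_) f
  · simp only [coeff_zero_compSmooth, PowerSeries.coeff_smul, compLeading_smul]
  · simp only [dEps_compSmooth, partialD_smul, dEps_smul, Finset.smul_sum, ← mul_smul_comm,
      map_sum, map_mul, hq]

theorem coeff_compFormal_eq_sum (f : Formal d) (w : Fin d → Formal d) {N M : ℕ} (h : N < M) :
    PowerSeries.coeff N (compFormal f w) = PowerSeries.coeff N
      (∑ k ∈ Finset.range M, PowerSeries.X ^ k * compSmooth (PowerSeries.coeff k f) w) := by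
  rw [coeff_compFormal, map_sum, Finset.Nat.sum_antidiagonal_eq_sum_range_succ_mk,
    ← Finset.sum_subset (Finset.range_mono (Nat.succ_le_of_lt h)) (fun n _ hn => by
      rw [PowerSeries.coeff_X_pow_mul', if_neg (by simpa using hn)])]
  refine Finset.sum_congr rfl fun n hn => ?_
  rw [PowerSeries.coeff_X_pow_mul', if_pos (Nat.lt_succ_iff.1 (Finset.mem_range.1 hn))]

theorem compFormal_add (f g : Formal d) (w : Fin d → Formal d) :
    compFormal (f + g) w = compFormal f w + compFormal g w := by
  ext1 n
  simp only [coeff_compFormal, map_add, compSmooth_add, Finset.sum_add_distrib]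

theorem compFormal_C (f : Smooth d) (w : Fin d → Formal d) :
    compFormal (PowerSeries.C f) w = compSmooth f w := by
  ext1 n
  rw [coeff_compFormal_eq_sum _ w n.lt_succ_self, Finset.sum_eq_single_of_mem 0 (by simp)
    (fun k _ hk => by rw [PowerSeries.coeff_C, if_neg hk, compSmooth_zero, mul_zero])]
  simp

theorem dEps_X_pow_succ (n : ℕ) :
    dEps ((PowerSeries.X : Formal d) ^ (n + 1)) = ((n + 1 : ℕ) : ℝ) • PowerSeries.X ^ n := by
  induction n with
  | zero => simp [dEps_X]
  | succ n ih =>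
    rw [pow_succ, dEps_mul, ih, dEps_X, Nat.cast_succ (n + 1), add_smul, smul_mul_assoc, one_smul,
      ← pow_succ, mul_one]

/-- The chain rule in the formal variable. -/
theorem dEps_compFormal (f : Formal d) (w : Fin d → Formal d) :
    dEps (compFormal f w) = compFormal (dEps f) w
      + ∑ j, dEps (w j) * compFormal (partialF (Sum.inl j) f) w := by
  ext1 N
  have h1 : PowerSeries.coeff N (dEps (compFormal f w)) = PowerSeries.coeff N (dEps
      (∑ k ∈ Finset.range (N + 2), PowerSeries.X ^ k * compSmooth (PowerSeries.coeff k f) w)) := by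
    rw [coeff_dEps, coeff_dEps, coeff_compFormal_eq_sum f w (Nat.lt_succ_self _)]
  have h2 : ∀ j, PowerSeries.coeff N (dEps (w j) * compFormal (partialF (Sum.inl j) f) w)
      = PowerSeries.coeff N (dEps (w j) * ∑ k ∈ Finset.range (N + 2),
        PowerSeries.X ^ k * compSmooth (partialD (Sum.inl j) (PowerSeries.coeff k f)) w) :=
    fun j => coeff_mul_congr_right fun m hm => by
      rw [coeff_compFormal_eq_sum _ w (show m < N + 2 by omega)]
      simp only [coeff_partialF]
  rw [h1, map_add, map_sum (PowerSeries.coeff N),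
    coeff_compFormal_eq_sum (dEps f) w (Nat.lt_succ_self N)]
  simp only [h2]
  rw [← map_sum, ← map_add]
  congr 1
  rw [dEps_sum]
  simp only [dEps_mul, Finset.sum_add_distrib, dEps_compSmooth, Finset.mul_sum]
  congr 1
  · rw [Finset.sum_range_succ', pow_zero, ← map_one PowerSeries.C, dEps_C, zero_mul, add_zero]
    refine Finset.sum_congr rfl fun k _ => ?_
    rw [dEps_X_pow_succ, coeff_dEps, compSmooth_smul, smul_mul_assoc, mul_smul_comm]
  · rw [Finset.sum_comm]
    refine Finset.sum_congr rfl fun j _ => Finset.sum_congr rfl fun k _ => ?_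
    ring

/-- No multinomial identity is needed: both sides have the same leading coefficient, and by the
Leibniz rules they obey the same first-order system in `ε`. -/
theorem compFormal_mul (f g : Formal d) (w : Fin d → Formal d) :
    compFormal (f * g) w = compFormal f w * compFormal g w := by
  refine eq_of_dEps_congr (ι := Formal d × Formal d)
    (E := fun x => compFormal (x.1 * x.2) w)
    (F := fun x => compFormal x.1 w * compFormal x.2 w) (fun x => ?_) (fun q hq x => ?_) (f, g)
  · simp only [coeff_zero_compFormal, coeff_zero_mul, compLeading_mul]
  · have h : ∀ a b, q (compFormal (a * b) w) = q (compFormal a w * compFormal b w) :=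
      fun a b => hq (a, b)
    simp only [dEps_compFormal, dEps_mul, partialF_mul, compFormal_add, map_add, map_sum, map_mul,
      h, mul_add, add_mul, Finset.sum_add_distrib, Finset.mul_sum, Finset.sum_mul]
    have e1 : ∀ j, q (dEps (w j)) * (q (compFormal (partialF (Sum.inl j) x.1) w) *
        q (compFormal x.2 w)) = q (dEps (w j)) * q (compFormal (partialF (Sum.inl j) x.1) w) *
        q (compFormal x.2 w) := fun j => by ring
    have e2 : ∀ j, q (dEps (w j)) * (q (compFormal x.1 w) *
        q (compFormal (partialF (Sum.inl j) x.2) w)) = q (compFormal x.1 w) * (q (dEps (w j)) *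
        q (compFormal (partialF (Sum.inl j) x.2) w)) := fun j => by ring
    simp only [e1, e2]
    ring

theorem compFormal_one (w : Fin d → Formal d) : compFormal (1 : Formal d) w = 1 := by
  refine eq_of_dEps_eq ?_ ?_
  · rw [coeff_zero_compFormal, PowerSeries.coeff_zero_one]
    rfl
  · have h : dEps (1 : Formal d) = 0 := dEps_C 1
    have h0 : compFormal (0 : Formal d) w = 0 := by
      rw [← map_zero PowerSeries.C, compFormal_C, compSmooth_zero, map_zero]
    simp only [dEps_compFormal, h, partialF_one, h0, mul_zero, Finset.sum_const_zero, add_zero]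

/-- Formal composition with a fixed formal map, as a ring homomorphism. -/
def compHom (w : Fin d → Formal d) : Formal d →+* Formal d where
  toFun f := compFormal f w
  map_one' := compFormal_one w
  map_mul' f g := compFormal_mul f g w
  map_zero' := by rw [← map_zero PowerSeries.C, compFormal_C, compSmooth_zero, map_zero]
  map_add' f g := compFormal_add f g w

theorem compHom_apply (w : Fin d → Formal d) (f : Formal d) : compHom w f = compFormal f w := rfl

theorem compFormal_X (w : Fin d → Formal d) :
    compFormal (PowerSeries.X : Formal d) w = PowerSeries.X := by
  refine eq_of_dEps_eq ?_ ?_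
  · rw [coeff_zero_compFormal, PowerSeries.coeff_zero_X]
    rfl
  · simp only [dEps_compFormal, dEps_X, partialF_X, compFormal_one]
    simp [← compHom_apply]

theorem compFormal_coord_inl (w : Fin d → Formal d) (i : Fin d) :
    compFormal (PowerSeries.C (coord (Sum.inl i))) w = w i := by
  refine eq_of_dEps_eq ?_ ?_
  · rw [coeff_zero_compFormal, PowerSeries.coeff_zero_C]
    rfl
  · simp only [dEps_compFormal, dEps_C, partialF_C, partialD_coord, Sum.inl.injEq, apply_ite,
      map_one, map_zero]
    simp [← compHom_apply]

theorem compFormal_coord_inr (w : Fin d → Formal d) (i : Fin d) :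
    compFormal (PowerSeries.C (coord (Sum.inr i))) w = PowerSeries.C (coord (Sum.inr i)) := by
  refine eq_of_dEps_eq ?_ ?_
  · rw [coeff_zero_compFormal, PowerSeries.coeff_zero_C]
    rfl
  · simp only [dEps_compFormal, dEps_C, partialF_C, partialD_coord]
    simp [← compHom_apply]

/-- The chain rule in the coordinates, for formal maps that start with the identity. -/
theorem partialF_compFormal {w : Fin d → Formal d}
    (hw : ∀ i, PowerSeries.coeff 0 (w i) = coord (Sum.inl i)) (a : Fin d ⊕ Fin d) (f : Formal d) :
    partialF a (compFormal f w) = ∑ b, jacobian w b a * compFormal (partialF b f) w := by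
  have hid : ∀ g : Smooth d, compLeading g (leadingCoeffs w) = g := fun g => by
    rw [show leadingCoeffs w = fun i => coord (Sum.inl i) from funext hw]
    refine Smooth.ext fun z => ?_
    change g.1 _ = g.1 z
    exact congrArg g.1 (funext fun b => by cases b <;> rfl)
  refine eq_of_dEps_congr (E := fun f => partialF a (compFormal f w))
    (F := fun f => ∑ b, jacobian w b a * compFormal (partialF b f) w)
    (fun f => ?_) (fun q hq f => ?_) f
  · have hJ : ∀ b, PowerSeries.coeff 0 (jacobian w b a) = if a = b then 1 else 0 := fun b => by
      rw [jacobian, Matrix.of_apply, coeff_partialF, ← partialD_coord]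
      cases b with
      | inl i => rw [Sum.elim_inl, hw]
      | inr i => rw [Sum.elim_inr, PowerSeries.coeff_zero_C]
    simp only [coeff_partialF, map_sum, coeff_zero_mul, coeff_zero_compFormal, hid, hJ]
    simp
  · have hq' : ∀ g, q (partialF a (compFormal g w))
        = ∑ b, q (jacobian w b a) * q (compFormal (partialF b g) w) := fun g => by
      rw [hq g, map_sum]; simp only [map_mul]
    -- The momentum rows of the Jacobian are constant in `ε`; only the position rows contribute to
    -- its derivative.
    have hJ : ∀ i, dEps (jacobian w (Sum.inr i) a) = 0 := fun i => by
      rw [jacobian, Matrix.of_apply, dEps_partialF, Sum.elim_inr, dEps_C, partialF_zero]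
    have hJ' : ∀ i, dEps (jacobian w (Sum.inl i) a) = partialF a (dEps (w i)) := fun i => by
      rw [jacobian, Matrix.of_apply, dEps_partialF, Sum.elim_inl]
    simp only [dEps_partialF, dEps_compFormal, partialF_add, partialF_sum, partialF_mul, dEps_sum,
      dEps_mul, map_add, map_sum, map_mul, hq', Finset.sum_add_distrib, mul_add, Finset.mul_sum]
    rw [Fintype.sum_sum_type (fun b => q (dEps (jacobian w b a)) * _)]
    simp only [hJ, hJ', map_zero, zero_mul, Finset.sum_const_zero, add_zero]
    rw [Finset.sum_comm (f := fun x i => q (dEps (w x)) * _)]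
    have e : ∀ b j, q (dEps (w j)) * (q (jacobian w b a) *
        q (compFormal (partialF b (partialF (Sum.inl j) f)) w)) = q (jacobian w b a) *
        (q (dEps (w j)) * q (compFormal (partialF (Sum.inl j) (partialF b f)) w)) :=
      fun b j => by rw [partialF_comm]; ring
    simp only [e]
    ring

/-- Formal composition is associative. -/
theorem compFormal_compFormal {v : Fin d → Formal d}
    (hv : ∀ i, PowerSeries.coeff 0 (v i) = coord (Sum.inl i)) (w : Fin d → Formal d)
    (f : Formal d) :
    compFormal (compFormal f v) w = compFormal f (compMap v w) := by
  refine eq_of_dEps_congr (E := fun f => compFormal (compFormal f v) w)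
    (F := fun f => compFormal f (compMap v w)) (fun f => ?_) (fun q hq f => ?_) f
  · simp only [coeff_zero_compFormal]
    have h : leadingCoeffs (compMap v w)
        = fun i => compLeading (leadingCoeffs v i) (leadingCoeffs w) :=
      funext fun i => coeff_zero_compFormal (v i) w
    rw [h]
    rfl
  · have hx : ∀ j g, partialF (Sum.inl j) (compFormal g v)
        = ∑ i, partialF (Sum.inl j) (v i) * compFormal (partialF (Sum.inl i) g) v := fun j g => by
      rw [partialF_compFormal hv, Fintype.sum_sum_type]
      simp [jacobian, partialF_C, partialD_coord]
    have hD : ∀ j, dEps (compMap v w j) = compFormal (dEps (v j)) w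
        + ∑ i, dEps (w i) * compFormal (partialF (Sum.inl i) (v j)) w := fun j =>
      dEps_compFormal (v j) w
    -- The terms from the inner and the outer map regroup into the derivative of `compMap v w`, so
    -- both sides obey the same chain rule.
    have h1 : dEps (compFormal (compFormal f v) w) = compFormal (compFormal (dEps f) v) w
        + ∑ j, dEps (compMap v w j) * compFormal (compFormal (partialF (Sum.inl j) f) v) w := by
      simp only [dEps_compFormal _ w, dEps_compFormal _ v, hx, hD]
      simp only [← compHom_apply w, map_add, map_sum, map_mul, add_mul, Finset.sum_add_distrib,
        Finset.sum_mul, Finset.mul_sum]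
      rw [Finset.sum_comm (f := fun x i => dEps (w x) * _), add_assoc]
      simp only [mul_assoc]
    simp only [h1, dEps_compFormal _ (compMap v w), map_add, map_sum, map_mul, hq]

/-! ### Inversion of formal maps -/

/-- Composition never uses coefficients of `w` of higher order than the one computed; an extra
factor `ε` then turns it into a contraction. -/
theorem coeff_compFormal_congr {w w' : Fin d → Formal d} {N : ℕ}
    (h : ∀ m ≤ N, ∀ j, PowerSeries.coeff m (w j) = PowerSeries.coeff m (w' j)) (f : Formal d) :
    PowerSeries.coeff N (compFormal f w) = PowerSeries.coeff N (compFormal f w') := by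
  induction N using Nat.strong_induction_on generalizing f with
  | _ N ih =>
    cases N with
    | zero =>
      rw [coeff_zero_compFormal, coeff_zero_compFormal,
        show leadingCoeffs w = leadingCoeffs w' from funext (h 0 le_rfl)]
    | succ n =>
      have ih' : ∀ m ≤ n, ∀ f, PowerSeries.coeff m (compFormal f w)
          = PowerSeries.coeff m (compFormal f w') := fun m hm f =>
        ih m (Nat.lt_succ_of_le hm) (fun k hk => h k (by omega)) f
      refine coeff_succ_eq_of_dEps ?_
      rw [dEps_compFormal, dEps_compFormal, map_add, map_add, map_sum, map_sum, ih' n le_rfl]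
      congr 1
      refine Finset.sum_congr rfl fun j _ => ?_
      rw [coeff_mul_congr_right (fun m hm => ih' m hm _)]
      refine coeff_mul_congr_left fun m hm => ?_
      rw [coeff_dEps, coeff_dEps, h (m + 1) (by omega)]

/-- The `ε`-adic Banach fixed point theorem: each application of `G` fixes one more coefficient, so
coefficient `n` is read off the iterate `n + 1`, started at zero. -/
theorem existsUnique_fixedPoint_of_contracting (G : (Fin d → Formal d) → Fin d → Formal d)
    (hG : ∀ N w w', (∀ m < N, ∀ j, PowerSeries.coeff m (w j) = PowerSeries.coeff m (w' j)) →
      ∀ m < N + 1, ∀ j, PowerSeries.coeff m (G w j) = PowerSeries.coeff m (G w' j)) :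
    ∃! w, G w = w := by
  have step : ∀ k, ∀ m < k, ∀ j, PowerSeries.coeff m (G^[k] 0 j)
      = PowerSeries.coeff m (G^[k + 1] 0 j) := by
    intro k
    induction k with
    | zero => intro m hm; omega
    | succ k ih =>
      have h := hG k _ _ ih
      rwa [← Function.iterate_succ_apply' G k, ← Function.iterate_succ_apply' G (k + 1)] at h
  have stable : ∀ k l, ∀ m < k, ∀ j, PowerSeries.coeff m (G^[k] 0 j)
      = PowerSeries.coeff m (G^[k + l] 0 j) := by
    intro k l m hm j
    induction l with
    | zero => rfl
    | succ l ih => rw [ih, ← add_assoc, step (k + l) m (by omega)]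
  let w : Fin d → Formal d := fun j =>
    PowerSeries.mk fun n => PowerSeries.coeff n (G^[n + 1] 0 j)
  have hw : ∀ k, ∀ m < k, ∀ j, PowerSeries.coeff m (w j)
      = PowerSeries.coeff m (G^[k] 0 j) := fun k m hm j => by
    obtain ⟨l, rfl⟩ := Nat.exists_eq_add_of_le (Nat.succ_le_of_lt hm)
    rw [PowerSeries.coeff_mk, stable (m + 1) l m m.lt_succ_self]
  refine ⟨w, funext fun j => ?_, fun v hv => funext fun j => ?_⟩
  · ext1 n
    have h := hG n w _ (hw n) n n.lt_succ_self j
    rw [← Function.iterate_succ_apply' G n] at h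
    rw [h, hw (n + 1) n n.lt_succ_self]
  · have key : ∀ N, ∀ m < N, ∀ j, PowerSeries.coeff m (v j) = PowerSeries.coeff m (G^[N] 0 j) := by
      intro N
      induction N with
      | zero => intro m hm; omega
      | succ N ih =>
        have h := hG N _ _ ih
        rwa [hv, ← Function.iterate_succ_apply' G N] at h
    ext1 n
    rw [key (n + 1) n n.lt_succ_self, hw (n + 1) n n.lt_succ_self]

/-- A formal map that starts with the identity. -/
def StartsWithId (w : Fin d → Formal d) : Prop :=
  ∀ i, PowerSeries.coeff 0 (w i) = coord (Sum.inl i)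

/-- This turns `φ ∘ α = x` into the fixed point equation `α = x - ε (tail φ) ∘ α`. -/
theorem StartsWithId.compMap_apply {φ : Fin d → Formal d} (hφ : StartsWithId φ)
    (w : Fin d → Formal d) (i : Fin d) :
    compMap φ w i = w i + PowerSeries.X * compFormal (tail (φ i)) w := by
  change compFormal (φ i) w = _
  conv_lhs => rw [eq_C_add_X_mul_tail (φ i), hφ i]
  rw [compFormal_add, compFormal_mul, compFormal_X, compFormal_coord_inl]

theorem StartsWithId.existsUnique_rightInverse {φ : Fin d → Formal d} (hφ : StartsWithId φ) :
    ∃! α : Fin d → Formal d, compMap φ α = proj d := by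
  have h : ∀ α : Fin d → Formal d, compMap φ α = proj d ↔
      (fun i => proj d i - PowerSeries.X * compFormal (tail (φ i)) α) = α := fun α => by
    rw [funext_iff, funext_iff]
    refine forall_congr' fun i => ?_
    rw [hφ.compMap_apply, sub_eq_iff_eq_add, eq_comm]
  simp only [h]
  refine existsUnique_fixedPoint_of_contracting
    (fun α i => proj d i - PowerSeries.X * compFormal (tail (φ i)) α) ?_
  intro N w w' hw m hm j
  cases m with
  | zero => simp
  | succ m =>
    simp only [map_sub, PowerSeries.coeff_succ_X_mul]
    rw [coeff_compFormal_congr fun k hk => hw k (by omega)]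

theorem StartsWithId.of_rightInverse {φ α : Fin d → Formal d} (hφ : StartsWithId φ)
    (h : compMap φ α = proj d) : StartsWithId α := fun i => by
  have h' := congrArg (PowerSeries.coeff 0) (congrFun h i)
  rw [hφ.compMap_apply, map_add, PowerSeries.coeff_zero_X_mul, add_zero, proj,
    PowerSeries.coeff_zero_C] at h'
  exact h'

theorem compFormal_proj (f : Formal d) : compFormal f (proj d) = f := by
  refine eq_of_dEps_congr (E := fun f => compFormal f (proj d)) (F := fun f => f)
    (fun f => ?_) (fun q hq f => ?_) f
  · rw [coeff_zero_compFormal]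
    have h : leadingCoeffs (proj d) = fun i => coord (Sum.inl i) :=
      funext fun i => PowerSeries.coeff_zero_C _
    rw [h]
    refine Smooth.ext fun z => ?_
    exact congrArg (PowerSeries.coeff 0 f).1 (funext fun b => by cases b <;> rfl)
  · simp only [dEps_compFormal, proj, dEps_C, zero_mul, Finset.sum_const_zero, add_zero]
    exact hq _

theorem proj_compMap (w : Fin d → Formal d) : compMap (proj d) w = w :=
  funext fun i => compFormal_coord_inl w i

/-- A right inverse of a formal map that starts with the identity is a left inverse. -/
theorem StartsWithId.leftInverse_of_rightInverse {φ α : Fin d → Formal d} (hφ : StartsWithId φ)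
    (h : compMap φ α = proj d) : compMap α φ = proj d := by
  have hα := hφ.of_rightInverse h
  -- `α` has a right inverse `β` in turn, and associativity gives `φ = φ ∘ (α ∘ β) = (φ ∘ α) ∘ β =
  -- β`.
  obtain ⟨β, hβ, -⟩ := hα.existsUnique_rightInverse
  have hφβ : φ = β := funext fun i => by
    have h1 := compFormal_compFormal hα β (φ i)
    rw [hβ, compFormal_proj] at h1
    rw [← h1, show compFormal (φ i) α = proj d i from congrFun h i]
    exact congrFun (proj_compMap β) i
  rw [hφβ]
  exact hβ

/-! ### The Poisson bracket along the fibres of `(x, p) ↦ p` -/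

namespace PoissonStructure

theorem lift_apply (P : PoissonStructure d) (i j : Fin d) (z : Phase d) :
    (P.lift i j).1 z = P.comp i j (fun k => z (Sum.inl k)) := rfl

theorem lift_antisymm (P : PoissonStructure d) (i j : Fin d) : P.lift i j = -P.lift j i :=
  Smooth.ext fun z => P.antisymm i j (fun k => z (Sum.inl k))

theorem partialD_lift_apply (P : PoissonStructure d) (a : Fin d ⊕ Fin d) (i j : Fin d)
    (z : Phase d) :
    (partialD a (P.lift i j)).1 z = fderiv ℝ (P.comp i j) (fun k => z (Sum.inl k))
      (fun k => (Pi.single a 1 : Phase d) (Sum.inl k)) := by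
  let R : Phase d →L[ℝ] (Fin d → ℝ) :=
    ContinuousLinearMap.pi fun k => ContinuousLinearMap.proj (Sum.inl k)
  have h : fderiv ℝ (P.comp i j ∘ R) z = (fderiv ℝ (P.comp i j) (R z)).comp (fderiv ℝ R z) :=
    fderiv_comp z ((P.smooth i j).differentiable (by simp) _) R.differentiableAt
  rw [R.fderiv] at h
  rw [partialD_apply]
  exact congrArg (fun T : Phase d →L[ℝ] ℝ => T (Pi.single a 1)) h

theorem partialD_inl_lift_apply (P : PoissonStructure d) (l i j : Fin d) (z : Phase d) :
    (partialD (Sum.inl l) (P.lift i j)).1 z = pderiv l (P.comp i j) (fun k => z (Sum.inl k)) := by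
  rw [partialD_lift_apply, pderiv]
  congr 1
  funext k
  simp [Pi.single_apply]

theorem partialD_inr_lift (P : PoissonStructure d) (l i j : Fin d) :
    partialD (Sum.inr l) (P.lift i j) = 0 := by
  refine Smooth.ext fun z => ?_
  rw [partialD_lift_apply]
  have h : (fun k => (Pi.single (Sum.inr l) 1 : Phase d) (Sum.inl k)) = 0 := by
    funext k
    simp
  rw [h, map_zero]
  rfl

theorem lift_jacobi (P : PoissonStructure d) (i j k : Fin d) :
    ∑ l, (P.lift i l * partialD (Sum.inl l) (P.lift j k)
      + P.lift j l * partialD (Sum.inl l) (P.lift k i)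
      + P.lift k l * partialD (Sum.inl l) (P.lift i j)) = 0 := by
  refine Smooth.ext fun z => ?_
  have h := P.jacobi i j k (fun k => z (Sum.inl k))
  simp only [← lift_apply, ← partialD_inl_lift_apply] at h
  simpa using h

/-- The components of the vector field `V̄`. -/
def vecV (P : PoissonStructure d) (a : Fin d) : Smooth d :=
  -∑ i, P.lift i a * coord (Sum.inr i)

theorem lieV_eq (P : PoissonStructure d) (f : Smooth d) :
    P.lieV f = ∑ a, P.vecV a * partialD (Sum.inl a) f := by
  simp only [lieV, vecV, Smooth.neg_mul, Finset.sum_mul, Finset.sum_neg_distrib]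
  rw [Finset.sum_comm]

theorem partialD_inl_vecV (P : PoissonStructure d) (a k : Fin d) :
    partialD (Sum.inl a) (P.vecV k)
      = -∑ i, partialD (Sum.inl a) (P.lift i k) * coord (Sum.inr i) := by
  simp only [vecV, partialD_neg, partialD_sum, partialD_mul, partialD_coord]
  simp

theorem partialD_inr_vecV (P : PoissonStructure d) (j a : Fin d) :
    partialD (Sum.inr j) (P.vecV a) = -P.lift j a := by
  simp only [vecV, partialD_neg, partialD_sum, partialD_mul, partialD_coord, partialD_inr_lift]
  simp

/-- The vector field `V̄` preserves the Poisson bivector field. -/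
theorem vecV_preserves (P : PoissonStructure d) (k l : Fin d) :
    ∑ a, P.vecV a * partialD (Sum.inl a) (P.lift k l)
      = ∑ a, (P.lift a l * partialD (Sum.inl a) (P.vecV k)
        + P.lift k a * partialD (Sum.inl a) (P.vecV l)) := by
  -- The Jacobi identity for `i, k, l` contracted with `p_i`; up to sign it is the difference of the
  -- two sides.
  have h : ∑ i, coord (Sum.inr i) *
      ∑ a, (P.lift i a * partialD (Sum.inl a) (P.lift k l)
      + P.lift k a * partialD (Sum.inl a) (P.lift l i)
      + P.lift l a * partialD (Sum.inl a) (P.lift i k)) = 0 := by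
    simp only [lift_jacobi, mul_zero, Finset.sum_const_zero]
  rw [← sub_eq_zero, ← neg_eq_zero, ← h]
  simp only [Finset.mul_sum]
  rw [Finset.sum_comm, ← Finset.sum_sub_distrib, ← Finset.sum_neg_distrib]
  refine Finset.sum_congr rfl fun a _ => ?_
  rw [partialD_inl_vecV, partialD_inl_vecV, vecV]
  simp only [Smooth.neg_mul, Smooth.mul_neg, Finset.mul_sum, Finset.sum_mul]
  rw [← Finset.sum_neg_distrib, ← Finset.sum_neg_distrib, ← Finset.sum_neg_distrib,
    ← Finset.sum_add_distrib, ← Finset.sum_sub_distrib, ← Finset.sum_neg_distrib]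
  refine Finset.sum_congr rfl fun i _ => ?_
  rw [P.lift_antisymm l i, P.lift_antisymm l a, partialD_neg]
  ring

/-- The Lie derivative along `V̄`, coefficient by coefficient. -/
def lieF (P : PoissonStructure d) (f : Formal d) : Formal d :=
  ∑ a, PowerSeries.C (P.vecV a) * partialF (Sum.inl a) f

theorem coeff_lieF (P : PoissonStructure d) (f : Formal d) (n : ℕ) :
    PowerSeries.coeff n (P.lieF f) = P.lieV (PowerSeries.coeff n f) := by
  simp only [lieF, lieV_eq, map_sum, PowerSeries.coeff_C_mul, coeff_partialF]

/-- The bracket `∑ π^{kl} ∂f/∂x^k ∂g/∂x^l`. -/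
def fibreBracket (P : PoissonStructure d) (f g : Formal d) : Formal d :=
  ∑ k, ∑ l, PowerSeries.C (P.lift k l) * partialF (Sum.inl k) f * partialF (Sum.inl l) g

theorem fibreBracket_antisymm (P : PoissonStructure d) (f g : Formal d) :
    P.fibreBracket f g = -P.fibreBracket g f := by
  unfold fibreBracket
  rw [Finset.sum_comm, ← Finset.sum_neg_distrib]
  refine Finset.sum_congr rfl fun k _ => ?_
  rw [← Finset.sum_neg_distrib]
  refine Finset.sum_congr rfl fun l _ => ?_
  rw [P.lift_antisymm l k, map_neg]
  ring

theorem fibreBracket_sub_right (P : PoissonStructure d) (f g h : Formal d) :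
    P.fibreBracket f (g - h) = P.fibreBracket f g - P.fibreBracket f h := by
  simp only [fibreBracket, partialF_sub, mul_sub, Finset.sum_sub_distrib]

theorem fibreBracket_X_mul (P : PoissonStructure d) (f g : Formal d) :
    P.fibreBracket (PowerSeries.X * f) (PowerSeries.X * g)
      = PowerSeries.X * (PowerSeries.X * P.fibreBracket f g) := by
  simp only [fibreBracket, partialF_mul, partialF_X, zero_mul, zero_add, Finset.mul_sum]
  refine Finset.sum_congr rfl fun k _ => Finset.sum_congr rfl fun l _ => ?_
  ring

theorem dEps_fibreBracket (P : PoissonStructure d) (f g : Formal d) :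
    dEps (P.fibreBracket f g) = P.fibreBracket (dEps f) g + P.fibreBracket f (dEps g) := by
  simp only [fibreBracket, dEps_sum, dEps_mul, dEps_C, zero_mul, zero_add, dEps_partialF,
    Finset.sum_add_distrib]

/-- The Lie derivative along `V̄` is a derivation of the bracket. -/
theorem lieF_fibreBracket (P : PoissonStructure d) (f g : Formal d) :
    P.lieF (P.fibreBracket f g) = P.fibreBracket (P.lieF f) g + P.fibreBracket f (P.lieF g) := by
  have hV : ∀ k l, ∑ a, PowerSeries.C (P.vecV a) *
      PowerSeries.C (partialD (Sum.inl a) (P.lift k l))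
      = ∑ a, (PowerSeries.C (P.lift a l) * PowerSeries.C (partialD (Sum.inl a) (P.vecV k))
        + PowerSeries.C (P.lift k a) * PowerSeries.C (partialD (Sum.inl a) (P.vecV l))) := by
    intro k l
    have h := congrArg (PowerSeries.C) (P.vecV_preserves k l)
    simpa only [map_sum, map_add, map_mul] using h
  -- `e1`, `e2` and `e3` only relabel sums, so that every term carries `∂f/∂x^k ∂g/∂x^l` or a
  -- derivative of one of its factors.
  have e1 : ∀ F : Fin d → Fin d → Fin d → Formal d,
      ∑ k, ∑ l, ∑ a, F k l a = ∑ k, ∑ l, ∑ a, F a l k := fun F => by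
    rw [Finset.sum_comm]
    conv_rhs => rw [Finset.sum_comm]
    exact Finset.sum_congr rfl fun l _ => Finset.sum_comm
  have e2 : ∀ F : Fin d → Fin d → Fin d → Formal d,
      ∑ k, ∑ l, ∑ a, F k l a = ∑ k, ∑ l, ∑ a, F k a l := fun F =>
    Finset.sum_congr rfl fun k _ => Finset.sum_comm
  have e3 : ∀ F : Fin d → Fin d → Fin d → Formal d,
      ∑ a, ∑ k, ∑ l, F a k l = ∑ k, ∑ l, ∑ a, F a k l := fun F => by
    rw [Finset.sum_comm]
    exact Finset.sum_congr rfl fun k _ => Finset.sum_comm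
  have hL : P.lieF (P.fibreBracket f g) = ∑ k, ∑ l,
      ((∑ a, PowerSeries.C (P.vecV a) * PowerSeries.C (partialD (Sum.inl a) (P.lift k l))) *
        (partialF (Sum.inl k) f * partialF (Sum.inl l) g)
      + ∑ a, PowerSeries.C (P.vecV a) * PowerSeries.C (P.lift k l) *
        (partialF (Sum.inl a) (partialF (Sum.inl k) f) * partialF (Sum.inl l) g
        + partialF (Sum.inl k) f * partialF (Sum.inl a) (partialF (Sum.inl l) g))) := by
    simp only [lieF, fibreBracket, partialF_sum, partialF_mul, partialF_C, Finset.mul_sum]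
    rw [e3]
    refine Finset.sum_congr rfl fun k _ => Finset.sum_congr rfl fun l _ => ?_
    rw [Finset.sum_mul, ← Finset.sum_add_distrib]
    refine Finset.sum_congr rfl fun a _ => ?_
    ring
  have hf : P.fibreBracket (P.lieF f) g = ∑ k, ∑ l, ∑ a,
      (PowerSeries.C (P.lift a l) * PowerSeries.C (partialD (Sum.inl a) (P.vecV k)) *
        (partialF (Sum.inl k) f * partialF (Sum.inl l) g))
      + ∑ k, ∑ l, ∑ a, PowerSeries.C (P.vecV a) * PowerSeries.C (P.lift k l) *
        (partialF (Sum.inl a) (partialF (Sum.inl k) f) * partialF (Sum.inl l) g) := by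
    rw [e1]
    simp only [lieF, fibreBracket, partialF_sum, partialF_mul, partialF_C, Finset.mul_sum,
      Finset.sum_mul, ← Finset.sum_add_distrib]
    refine Finset.sum_congr rfl fun k _ => Finset.sum_congr rfl fun l _ =>
      Finset.sum_congr rfl fun a _ => ?_
    rw [partialF_comm (Sum.inl a)]
    ring
  have hg : P.fibreBracket f (P.lieF g) = ∑ k, ∑ l, ∑ a,
      (PowerSeries.C (P.lift k a) * PowerSeries.C (partialD (Sum.inl a) (P.vecV l)) *
        (partialF (Sum.inl k) f * partialF (Sum.inl l) g))
      + ∑ k, ∑ l, ∑ a, PowerSeries.C (P.vecV a) * PowerSeries.C (P.lift k l) *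
        (partialF (Sum.inl k) f * partialF (Sum.inl a) (partialF (Sum.inl l) g)) := by
    rw [e2]
    simp only [lieF, fibreBracket, partialF_sum, partialF_mul, partialF_C, Finset.mul_sum,
      ← Finset.sum_add_distrib]
    refine Finset.sum_congr rfl fun k _ => Finset.sum_congr rfl fun l _ =>
      Finset.sum_congr rfl fun a _ => ?_
    rw [partialF_comm (Sum.inl a)]
    ring
  rw [hL, hf, hg]
  simp only [hV, Finset.sum_mul, ← Finset.sum_add_distrib]
  refine Finset.sum_congr rfl fun k _ => Finset.sum_congr rfl fun l _ =>
    Finset.sum_congr rfl fun a _ => ?_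
  ring

theorem fibreBracket_coord_left (P : PoissonStructure d) (j : Fin d) (f : Formal d) :
    P.fibreBracket (PowerSeries.C (coord (Sum.inl j))) f
      = ∑ l, PowerSeries.C (P.lift j l) * partialF (Sum.inl l) f := by
  simp only [fibreBracket, partialF_C, partialD_coord]
  rw [Finset.sum_eq_single_of_mem j (Finset.mem_univ j) (fun k _ hk => by simp [hk])]
  simp

/-- `V̄` is linear in the momenta with `∂V̄^l/∂p_j = -π^{jl}`, so its commutator with `∂/∂p_j` is
the derivation generated by `x^j`, up to sign. -/
theorem partialF_inr_lieF (P : PoissonStructure d) (j : Fin d) (f : Formal d) :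
    partialF (Sum.inr j) (P.lieF f) = P.lieF (partialF (Sum.inr j) f)
      - P.fibreBracket (PowerSeries.C (coord (Sum.inl j))) f := by
  rw [fibreBracket_coord_left]
  simp only [lieF, partialF_sum, partialF_mul, partialF_C, partialD_inr_vecV, map_neg, Formal.neg_mul,
    Finset.sum_add_distrib, Finset.sum_neg_distrib, partialF_comm (Sum.inr j)]
  ring

theorem lieF_sub (P : PoissonStructure d) (f g : Formal d) :
    P.lieF (f - g) = P.lieF f - P.lieF g := by
  simp only [lieF, partialF_sub, mul_sub, Finset.sum_sub_distrib]

theorem dEps_lieF (P : PoissonStructure d) (f : Formal d) : dEps (P.lieF f) = P.lieF (dEps f) := by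
  simp only [lieF, dEps_sum, dEps_mul, dEps_C, zero_mul, zero_add, dEps_partialF]

theorem lieV_zero (P : PoissonStructure d) : P.lieV 0 = 0 := by
  simp only [lieV_eq, partialD_zero, mul_zero, Finset.sum_const_zero]

theorem lieV_smul (P : PoissonStructure d) (r : ℝ) (f : Smooth d) :
    P.lieV (r • f) = r • P.lieV f := by
  simp only [lieV_eq, partialD_smul, mul_smul_comm, Finset.smul_sum]

/-- Uniqueness for the formal transport equation: each coefficient is determined by the preceding
one. -/
theorem eq_zero_of_dEps_eq_lieF (P : PoissonStructure d) {f : Formal d}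
    (h0 : PowerSeries.coeff 0 f = 0) (h : dEps f = P.lieF f) : f = 0 := by
  ext1 n
  rw [map_zero]
  induction n with
  | zero => exact h0
  | succ n ih =>
    have h' : PowerSeries.coeff n (dEps f) = PowerSeries.coeff n (dEps (0 : Formal d)) := by
      rw [h, coeff_lieF, ih, lieV_zero, dEps_zero, map_zero]
    rw [coeff_succ_eq_of_dEps h', map_zero]

/-! ### The flow of `V̄` -/

theorem coeff_flow (P : PoissonStructure d) (i : Fin d) (n : ℕ) :
    PowerSeries.coeff n (P.flow i)
      = ((n.factorial : ℝ)⁻¹) • (P.lieV)^[n] (coord (Sum.inl i)) :=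
  PowerSeries.coeff_mk _ _

theorem coeff_phi (P : PoissonStructure d) (i : Fin d) (n : ℕ) :
    PowerSeries.coeff n (P.phi i)
      = (((n + 1).factorial : ℝ)⁻¹) • (P.lieV)^[n] (coord (Sum.inl i)) :=
  PowerSeries.coeff_mk _ _

theorem succ_mul_inv_factorial_succ (n : ℕ) :
    ((n + 1 : ℕ) : ℝ) * ((n + 1).factorial : ℝ)⁻¹ = (n.factorial : ℝ)⁻¹ := by
  rw [Nat.factorial_succ]
  push_cast
  field_simp

theorem coeff_zero_flow (P : PoissonStructure d) (i : Fin d) :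
    PowerSeries.coeff 0 (P.flow i) = coord (Sum.inl i) := by
  simp [coeff_flow, - PowerSeries.coeff_zero_eq_constantCoeff]

theorem coeff_zero_phi (P : PoissonStructure d) (i : Fin d) :
    PowerSeries.coeff 0 (P.phi i) = coord (Sum.inl i) := by
  simp [coeff_phi, - PowerSeries.coeff_zero_eq_constantCoeff]

theorem dEps_flow (P : PoissonStructure d) (i : Fin d) : dEps (P.flow i) = P.lieF (P.flow i) := by
  ext1 n
  rw [coeff_dEps, coeff_lieF, coeff_flow, coeff_flow, lieV_smul, smul_smul,
    succ_mul_inv_factorial_succ, Function.iterate_succ_apply']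

/-- `X * phi` is the integral `∫_0^ε x̄ ds` without the factor `1/ε`; the differential equations
below are stated for it. -/
theorem dEps_X_mul_phi (P : PoissonStructure d) (i : Fin d) :
    dEps (PowerSeries.X * P.phi i) = P.flow i := by
  ext1 n
  rw [coeff_dEps, PowerSeries.coeff_succ_X_mul, coeff_phi, coeff_flow, smul_smul,
    succ_mul_inv_factorial_succ]

theorem lieF_X_mul_phi (P : PoissonStructure d) (i : Fin d) :
    P.lieF (PowerSeries.X * P.phi i) = P.flow i - PowerSeries.C (coord (Sum.inl i)) := by
  refine eq_of_dEps_eq ?_ ?_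
  · rw [coeff_lieF, PowerSeries.coeff_zero_X_mul, lieV_zero, map_sub, coeff_zero_flow,
      PowerSeries.coeff_zero_C, sub_self]
  · rw [dEps_lieF, dEps_X_mul_phi, dEps_sub, dEps_C, sub_zero, dEps_flow]

theorem coeff_zero_fibreBracket_X_mul (P : PoissonStructure d) (f g : Formal d) :
    PowerSeries.coeff 0 (P.fibreBracket f (PowerSeries.X * g)) = 0 := by
  simp only [fibreBracket, partialF_mul, partialF_X, zero_mul, zero_add, map_sum]
  simp

/-- Applying `d/dε - L_V̄` to either side gives `{x̄^i, x^j}_π`: on the left from the commutator of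
`∂/∂p_j` with `V̄`, on the right from the term `-x^j` in `lieF_X_mul_phi`. Both sides vanish at `ε =
0`. -/
theorem partialF_inr_flow (P : PoissonStructure d) (i j : Fin d) :
    partialF (Sum.inr j) (P.flow i) = P.fibreBracket (P.flow i) (PowerSeries.X * P.phi j) := by
  rw [← sub_eq_zero]
  refine P.eq_zero_of_dEps_eq_lieF ?_ ?_
  · rw [map_sub, coeff_zero_fibreBracket_X_mul, coeff_partialF, coeff_zero_flow, partialD_coord]
    simp
  · rw [dEps_sub, dEps_partialF, dEps_flow, partialF_inr_lieF, dEps_fibreBracket, dEps_flow,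
      dEps_X_mul_phi, lieF_sub, lieF_fibreBracket, lieF_X_mul_phi, fibreBracket_sub_right,
      P.fibreBracket_antisymm (PowerSeries.C _)]
    ring

/-- The failure of the momentum derivatives of `φ_ε` to be symmetric is measured by `π`. -/
theorem partialF_inr_phi_sub (P : PoissonStructure d) (i j : Fin d) :
    partialF (Sum.inr j) (P.phi i) - partialF (Sum.inr i) (P.phi j)
      = PowerSeries.X * P.fibreBracket (P.phi i) (P.phi j) := by
  have h : partialF (Sum.inr j) (PowerSeries.X * P.phi i)
      - partialF (Sum.inr i) (PowerSeries.X * P.phi j)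
      = P.fibreBracket (PowerSeries.X * P.phi i) (PowerSeries.X * P.phi j) := by
    refine eq_of_dEps_eq ?_ ?_
    · rw [coeff_zero_fibreBracket_X_mul, map_sub, coeff_partialF, coeff_partialF,
        PowerSeries.coeff_zero_X_mul, PowerSeries.coeff_zero_X_mul, partialD_zero, partialD_zero,
        sub_zero]
    · rw [dEps_sub, dEps_partialF, dEps_partialF, dEps_fibreBracket, dEps_X_mul_phi,
        dEps_X_mul_phi, partialF_inr_flow, partialF_inr_flow,
        P.fibreBracket_antisymm (P.flow j)]
      ring
  -- The left side carries one factor `ε` and the right side two; one is cancelled.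
  rw [fibreBracket_X_mul, partialF_mul, partialF_mul, partialF_X, partialF_X, zero_mul, zero_mul,
    zero_add, zero_add, ← mul_sub] at h
  exact PowerSeries.X_mul_cancel h

end PoissonStructure

/-! ### Pullbacks of the canonical form -/

/-- The derivatives `∂w^i/∂x^j`. -/
def jacobianX (w : Fin d → Formal d) : Matrix (Fin d) (Fin d) (Formal d) :=
  Matrix.of fun i j => partialF (Sum.inl j) (w i)

/-- The derivatives `∂w^i/∂p_j`. -/
def jacobianP (w : Fin d → Formal d) : Matrix (Fin d) (Fin d) (Formal d) :=
  Matrix.of fun i j => partialF (Sum.inr j) (w i)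

theorem jacobian_eq_fromBlocks (w : Fin d → Formal d) :
    jacobian w = Matrix.fromBlocks (jacobianX w) (jacobianP w) 0 1 := by
  ext1 a b
  rcases a with i | i <;> rcases b with j | j
  · rfl
  · rfl
  · simp [jacobian, partialF_C, partialD_coord]
  · simp [jacobian, partialF_C, partialD_coord, Matrix.one_apply, eq_comm]

theorem omega0_map (q : Formal d →+* Formal d) : (omega0 d).map q = omega0 d := by
  rw [omega0, Matrix.fromBlocks_map, Matrix.map_zero _ (map_zero q),
    Matrix.map_one _ (map_zero q) (map_one q)]
  congr 1
  ext1 i j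
  simp [Matrix.one_apply, apply_ite q]

theorem pullback_omega0 (w : Fin d → Formal d) :
    pullback w (omega0 d) = (jacobian w).transpose * omega0 d * jacobian w := by
  rw [pullback, show (omega0 d).map (fun f => compFormal f w) = omega0 d from
    omega0_map (compHom w)]

/-- This is `∑ dp_i ∧ dw^i`. Its entries are linear in `w`, so averaging passes through them. -/
theorem pullback_omega0_eq_fromBlocks (w : Fin d → Formal d) :
    pullback w (omega0 d) = Matrix.fromBlocks 0 (-(jacobianX w).transpose) (jacobianX w)
      (jacobianP w - (jacobianP w).transpose) := by
  rw [pullback_omega0, jacobian_eq_fromBlocks, omega0, Matrix.fromBlocks_transpose,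
    Matrix.fromBlocks_multiply, Matrix.fromBlocks_multiply]
  simp [sub_eq_add_neg, add_comm]

/-! ### Averages in the formal variable. -/

theorem coeff_average (f : Formal d) (n : ℕ) :
    PowerSeries.coeff n (average f) = ((n + 1 : ℝ)⁻¹) • PowerSeries.coeff n f :=
  PowerSeries.coeff_mk _ _

theorem average_zero : average (0 : Formal d) = 0 := by
  ext1 n
  rw [coeff_average, map_zero, smul_zero]

theorem average_neg (f : Formal d) : average (-f) = -average f := by
  ext1 n
  rw [coeff_average, map_neg, map_neg, coeff_average, smul_neg]

theorem average_sub (f g : Formal d) : average (f - g) = average f - average g := by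
  ext1 n
  rw [coeff_average, map_sub, map_sub, coeff_average, coeff_average, smul_sub]

theorem average_partialF (a : Fin d ⊕ Fin d) (f : Formal d) :
    average (partialF a f) = partialF a (average f) := by
  ext1 n
  rw [coeff_average, coeff_partialF, coeff_partialF, coeff_average, partialD_smul]

theorem PoissonStructure.average_flow (P : PoissonStructure d) (i : Fin d) :
    average (P.flow i) = P.phi i := by
  ext1 n
  rw [coeff_average, P.coeff_flow, P.coeff_phi, smul_smul,
    ← PoissonStructure.succ_mul_inv_factorial_succ, ← mul_assoc]
  have h : ((n : ℝ) + 1) ≠ 0 := by positivity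
  push_cast
  rw [inv_mul_cancel₀ h, one_mul]

theorem PoissonStructure.omegaV_eq (P : PoissonStructure d) :
    P.omegaV = pullback P.phi (omega0 d) := by
  rw [omegaV, pullback_omega0_eq_fromBlocks, pullback_omega0_eq_fromBlocks,
    Matrix.fromBlocks_map]
  congr 1 <;> ext1 i j
  · exact average_zero
  · simp only [Matrix.map_apply, Matrix.neg_apply, Matrix.transpose_apply, jacobianX,
      Matrix.of_apply, average_neg, average_partialF, P.average_flow]
  · simp only [Matrix.map_apply, jacobianX, Matrix.of_apply, average_partialF, P.average_flow]
  · simp only [Matrix.map_apply, Matrix.sub_apply, Matrix.transpose_apply, jacobianP,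
      Matrix.of_apply, average_sub, average_partialF, P.average_flow]

/-- The pullback is exact; in every block the terms cancel by symmetry of second derivatives. -/
theorem pullback_omega0_closed (w : Fin d → Formal d) (a b c : Fin d ⊕ Fin d) :
    partialF a (pullback w (omega0 d) b c) + partialF b (pullback w (omega0 d) c a)
      + partialF c (pullback w (omega0 d) a b) = 0 := by
  rw [pullback_omega0_eq_fromBlocks]
  rcases a with i | i <;> rcases b with j | j <;> rcases c with k | k <;>
  simp only [Matrix.fromBlocks_apply₁₁, Matrix.fromBlocks_apply₁₂, Matrix.fromBlocks_apply₂₁,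
    Matrix.fromBlocks_apply₂₂, Matrix.zero_apply, Matrix.neg_apply, Matrix.sub_apply,
    Matrix.transpose_apply, jacobianX, jacobianP, Matrix.of_apply, partialF_zero, partialF_neg,
    partialF_sub]
  · simp
  · rw [partialF_comm (Sum.inl j)]; ring
  · rw [partialF_comm (Sum.inl i)]; ring
  · rw [partialF_comm (Sum.inl i), partialF_comm (Sum.inl i) (Sum.inr j)]; ring
  · rw [partialF_comm (Sum.inl j)]; ring
  · rw [partialF_comm (Sum.inl j), partialF_comm (Sum.inl j) (Sum.inr k)]; ring
  · rw [partialF_comm (Sum.inl k), partialF_comm (Sum.inl k) (Sum.inr i)]; ring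
  · rw [partialF_comm (Sum.inr i) (Sum.inr k), partialF_comm (Sum.inr i) (Sum.inr j),
      partialF_comm (Sum.inr j) (Sum.inr k)]
    ring

/-- Modulo `ε` the matrix is the identity, and a power series with invertible constant term is
invertible. -/
theorem isUnit_det_jacobianX {w : Fin d → Formal d} (hw : StartsWithId w) :
    IsUnit (jacobianX w).det := by
  rw [PowerSeries.isUnit_iff_constantCoeff, RingHom.map_det]
  have h : PowerSeries.constantCoeff.mapMatrix (jacobianX w) = 1 := by
    ext1 i j
    rw [RingHom.mapMatrix_apply, Matrix.map_apply, jacobianX, Matrix.of_apply,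
      ← PowerSeries.coeff_zero_eq_constantCoeff_apply, coeff_partialF, hw i, partialD_coord]
    simp [Matrix.one_apply, eq_comm]
  rw [h, Matrix.det_one]
  exact isUnit_one

theorem pullback_omega0_transpose (w : Fin d → Formal d) :
    (pullback w (omega0 d)).transpose = -pullback w (omega0 d) := by
  rw [pullback_omega0_eq_fromBlocks, Matrix.fromBlocks_transpose, Matrix.fromBlocks_neg]
  simp

theorem omega0_mul_neg_omega0 : omega0 d * -omega0 d = 1 := by
  rw [omega0, Matrix.fromBlocks_neg, Matrix.fromBlocks_multiply]
  simp

theorem jacobian_proj : jacobian (proj d) = 1 := by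
  ext1 a b
  rcases a with i | i <;> rcases b with j | j <;>
  simp [jacobian, proj, partialF_C, partialD_coord, Matrix.one_apply, eq_comm]

theorem isFormalSymplectic_omega0 : IsFormalSymplectic (omega0 d) := by
  have h : pullback (proj d) (omega0 d) = omega0 d := by
    rw [pullback_omega0, jacobian_proj, Matrix.transpose_one, one_mul, mul_one]
  refine ⟨?_, ?_, Matrix.isUnit_det_of_right_inverse omega0_mul_neg_omega0⟩
  · rw [← h, pullback_omega0_transpose]
  · intro a b c
    rw [← h, pullback_omega0_closed]

/-! ### The formal Weinstein realization -/

namespace PoissonStructure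

theorem startsWithId_phi (P : PoissonStructure d) : StartsWithId P.phi := P.coeff_zero_phi

/-- The matrix of the components `π^{ij}`. -/
def liftMatrix (P : PoissonStructure d) : Matrix (Fin d) (Fin d) (Formal d) :=
  Matrix.of fun i j => PowerSeries.C (P.lift i j)

theorem jacobianP_phi_sub_transpose (P : PoissonStructure d) :
    jacobianP P.phi - (jacobianP P.phi).transpose
      = jacobianX P.phi * ((PowerSeries.X : Formal d) • P.liftMatrix) *
        (jacobianX P.phi).transpose := by
  ext1 i j
  rw [Matrix.sub_apply, Matrix.transpose_apply, jacobianP, Matrix.of_apply, Matrix.of_apply,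
    P.partialF_inr_phi_sub, fibreBracket]
  simp only [Matrix.mul_apply, Matrix.transpose_apply, Matrix.smul_apply, jacobianX, liftMatrix,
    Matrix.of_apply, smul_eq_mul, Finset.mul_sum, Finset.sum_mul]
  rw [Finset.sum_comm]
  refine Finset.sum_congr rfl fun k _ => Finset.sum_congr rfl fun l _ => ?_
  ring

/-- The Poisson tensor of the formal Weinstein form. -/
def poissonV (P : PoissonStructure d) : FMatrix d :=
  Matrix.fromBlocks ((PowerSeries.X : Formal d) • P.liftMatrix) (jacobianX P.phi)⁻¹
    (-((jacobianX P.phi)⁻¹).transpose) 0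

theorem poissonV_inl_inl (P : PoissonStructure d) (i j : Fin d) :
    P.poissonV (Sum.inl i) (Sum.inl j) = PowerSeries.X * PowerSeries.C (P.lift i j) := by
  rw [poissonV, Matrix.fromBlocks_apply₁₁, Matrix.smul_apply, liftMatrix, Matrix.of_apply,
    smul_eq_mul]

/-- With `C = B - Bᵀ`, the inverse of the block matrix `(0, -Aᵀ; A, C)` has upper left block `A⁻¹ C
A⁻ᵀ`, and `jacobianP_phi_sub_transpose` says that this is `επ`. -/
theorem omegaV_mul_poissonV (P : PoissonStructure d) : P.omegaV * P.poissonV = 1 := by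
  have hu := isUnit_det_jacobianX P.startsWithId_phi
  have h1 : jacobianX P.phi * (jacobianX P.phi)⁻¹ = 1 := Matrix.mul_nonsing_inv _ hu
  have h2 : (jacobianX P.phi).transpose * ((jacobianX P.phi)⁻¹).transpose = 1 := by
    rw [← Matrix.transpose_mul, Matrix.nonsing_inv_mul _ hu, Matrix.transpose_one]
  rw [omegaV_eq, pullback_omega0_eq_fromBlocks, jacobianP_phi_sub_transpose, poissonV,
    Matrix.fromBlocks_multiply, ← Matrix.fromBlocks_one]
  congr 1
  · rw [zero_mul, zero_add, Matrix.neg_mul, Matrix.mul_neg, neg_neg, h2]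
  · rw [zero_mul, mul_zero, add_zero]
  · rw [Matrix.mul_neg, Matrix.mul_assoc _ (jacobianX P.phi).transpose, h2, mul_one, add_neg_cancel]
  · rw [h1, mul_zero, add_zero]

theorem isFormalSymplectic_omegaV (P : PoissonStructure d) : IsFormalSymplectic P.omegaV := by
  refine ⟨?_, ?_, Matrix.isUnit_det_of_right_inverse P.omegaV_mul_poissonV⟩
  · rw [omegaV_eq, pullback_omega0_transpose]
  · intro a b c
    rw [omegaV_eq, pullback_omega0_closed]

end PoissonStructure

/-! ### The bracket as a matrix product, and its transport along the inverse map. -/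

theorem bracket_eq_jacobian (Ω : FMatrix d) (w : Fin d → Formal d) (i j : Fin d) :
    bracket Ω (w i) (w j)
      = (jacobian w * Ω⁻¹ * (jacobian w).transpose) (Sum.inl i) (Sum.inl j) := by
  have hJ : ∀ i a, jacobian w (Sum.inl i) a = partialF a (w i) := fun i a => rfl
  simp only [bracket, Matrix.mul_apply, Matrix.transpose_apply, hJ, Finset.sum_mul]
  rw [Finset.sum_comm]
  refine Finset.sum_congr rfl fun b _ => Finset.sum_congr rfl fun a _ => ?_
  ring

theorem compSmooth_proj (f : Smooth d) : compSmooth f (proj d) = PowerSeries.C f := by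
  rw [← compFormal_C, compFormal_proj]

namespace PoissonStructure

/-- The bundle projection is the formal Weinstein realization. -/
theorem isFormalRealization_proj (P : PoissonStructure d) :
    IsFormalRealization P P.omegaV (proj d) := by
  refine ⟨P.isFormalSymplectic_omegaV, fun i => PowerSeries.coeff_zero_C _, fun i j => ?_⟩
  rw [bracket_eq_jacobian, jacobian_proj, Matrix.transpose_one, mul_one, one_mul,
    Matrix.inv_eq_right_inv P.omegaV_mul_poissonV, compSmooth_proj, poissonV_inl_inl]

/-- The chain rule applied to `φ ∘ α = x`, together with the fixed momenta. -/
theorem jacobian_map_mul_jacobian (P : PoissonStructure d) {α : Fin d → Formal d}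
    (h : compMap P.phi α = proj d) :
    (jacobian P.phi).map (compHom α) * jacobian α = 1 := by
  have hα := P.startsWithId_phi.of_rightInverse h
  have key : ∀ a f g, compFormal f α = g →
      partialF a g = ∑ b, compFormal (partialF b f) α * jacobian α b a := by
    rintro a f _ rfl
    rw [partialF_compFormal hα]
    exact Finset.sum_congr rfl fun b _ => mul_comm _ _
  rw [← jacobian_proj]
  ext1 a b
  rw [Matrix.mul_apply]
  rcases a with i | i
  · exact (key b (P.phi i) (proj d i) (congrFun h i)).symm
  · exact (key b _ _ (compFormal_coord_inr α i)).symm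

theorem omegaV_map (P : PoissonStructure d) (α : Fin d → Formal d) :
    P.omegaV.map (compHom α) = ((jacobian P.phi).map (compHom α)).transpose * omega0 d *
      (jacobian P.phi).map (compHom α) := by
  rw [omegaV_eq, pullback_omega0, Matrix.map_mul, Matrix.map_mul, omega0_map, Matrix.transpose_map]

theorem pullback_omegaV (P : PoissonStructure d) {α : Fin d → Formal d}
    (h : compMap P.phi α = proj d) : pullback α P.omegaV = omega0 d := by
  have hJ := P.jacobian_map_mul_jacobian h
  have hJ' : (jacobian α).transpose * ((jacobian P.phi).map (compHom α)).transpose = 1 := by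
    rw [← Matrix.transpose_mul, hJ, Matrix.transpose_one]
  change (jacobian α).transpose * P.omegaV.map (compHom α) * jacobian α = omega0 d
  rw [omegaV_map, ← Matrix.mul_assoc, ← Matrix.mul_assoc, hJ', one_mul, Matrix.mul_assoc, hJ,
    mul_one]

/-- Both `J ω₀⁻¹ Jᵀ`, with `J` the Jacobian of `α`, and `poissonV` composed with `α` are right
inverses of `omegaV` composed with `α`, hence equal; their position blocks give the bracket
relation. -/
theorem isFormalRealization_omega0 (P : PoissonStructure d) {α : Fin d → Formal d}
    (h : compMap P.phi α = proj d) : IsFormalRealization P (omega0 d) α := by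
  refine ⟨isFormalSymplectic_omega0, P.startsWithId_phi.of_rightInverse h, fun i j => ?_⟩
  have hJ := P.jacobian_map_mul_jacobian h
  have hJ' := mul_eq_one_comm.1 hJ
  have h1 : P.omegaV.map (compHom α) * P.poissonV.map (compHom α) = 1 := by
    rw [← Matrix.map_mul, P.omegaV_mul_poissonV, Matrix.map_one _ (map_zero _) (map_one _)]
  have h2 : P.omegaV.map (compHom α) *
      (jacobian α * (omega0 d)⁻¹ * (jacobian α).transpose) = 1 := by
    have h3 : omega0 d * (omega0 d)⁻¹ = 1 :=
      Matrix.mul_nonsing_inv _ isFormalSymplectic_omega0.nondegenerate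
    calc P.omegaV.map (compHom α) * (jacobian α * (omega0 d)⁻¹ * (jacobian α).transpose)
        = ((jacobian P.phi).map (compHom α)).transpose * (omega0 d *
          ((jacobian P.phi).map (compHom α) * jacobian α) * (omega0 d)⁻¹) *
          (jacobian α).transpose := by
          rw [omegaV_map]; simp only [Matrix.mul_assoc]
      _ = (jacobian α * (jacobian P.phi).map (compHom α)).transpose := by
          rw [hJ, mul_one, h3, mul_one, Matrix.transpose_mul]
      _ = 1 := by rw [hJ', Matrix.transpose_one]
  have h4 : jacobian α * (omega0 d)⁻¹ * (jacobian α).transpose = P.poissonV.map (compHom α) := by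
    rw [← Matrix.inv_eq_right_inv h1, Matrix.inv_eq_right_inv h2]
  rw [bracket_eq_jacobian, h4]
  rw [Matrix.map_apply, poissonV_inl_inl, compHom_apply, compFormal_mul, compFormal_X, compFormal_C]

end PoissonStructure

end FormalRealization

end

theorem mainTheorem5 (d : ℕ) (P : FormalRealization.PoissonStructure d) :
    (∃! α : Fin d → FormalRealization.Formal d,
      FormalRealization.compMap P.phi α = FormalRealization.proj d) ∧
    ∀ α : Fin d → FormalRealization.Formal d,
      FormalRealization.compMap P.phi α = FormalRealization.proj d →
        FormalRealization.IsFormalRealization P (FormalRealization.omega0 d) α ∧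
        FormalRealization.IsFormalRealization P P.omegaV (FormalRealization.proj d) ∧
        FormalRealization.IsFormalDarbouxFrame P.omegaV α P.phi ∧
        FormalRealization.compMap (FormalRealization.proj d) α = α := by
  refine ⟨P.startsWithId_phi.existsUnique_rightInverse, fun α h =>
    ⟨P.isFormalRealization_omega0 h, P.isFormalRealization_proj, ?_,
      FormalRealization.proj_compMap α⟩⟩
  exact ⟨h, P.startsWithId_phi.leftInverse_of_rightInverse h, P.pullback_omegaV h⟩
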